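/- Let $\mathbb T^2=\mathbb R^2/\mathbb Z^2$ with normalized Lebesgue measure, $\mathbb Z^2_0=\mathbb Z^2\setminus\{0\}$, $\mathbb Z^2_+=\{k\in\mathbb Z^2_0: k_1>0\text{ or }(k_1=0,\ k_2>0)\}$, and let $e_k(x)=\sqrt2\cos(2\pi k\cdot x)$ for $k\in\mathbb Z^2_+$ and $e_k(x)=\sqrt2\sin(2\pi k\cdot x)$ for $k\in\mathbb Z^2_0\setminus\mathbb Z^2_+$. Let $H^{-1-}=\bigcap_{s>0}H^{-1-s}(\mathbb T^2)$ (real distributions) and let $\mu$ be the law of white noise on $H^{-1-}$: a Borel probability measure under which $\langle\omega,\phi\rangle$ is a centred Gaussian variable of variance $\|\phi\|_{L^2(\mathbb T^2)}^2$ for every real $\phi\in C^\infty(\mathbb T^2)$ of zero average (the law of the mean $\langle\omega,1\rangle$ is irrelevant). Let $K\in L^1(\mathbb T^2;\mathbb R^2)$ be the Biot–Savart kernel, with Fourier series $K(x)=2\pi i\sum_{k\in\mathbb Z^2_0}\frac{k^\perp}{|k|^2}e^{2\pi i k\cdot x}$, $k^\perp=(k_2,-k_1)$, and put $u(f)(x)=\int_{\mathbb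 T^2}K(x-y)f(y)\,dy$. For $N\in\mathbb N$ let $\Lambda_N=\{k\in\mathbb Z^2_0:\max(|k_1|,|k_2|)\le N\}$ and $\omega_N=\Pi_N\omega=\sum_{k\in\Lambda_N}\langle\omega,e_k\rangle e_k$. Let $\Lambda\subset\mathbb Z^2_0$ be finite, let $g\in C^\infty(\mathbb R^\Lambda)$ have polynomial growth together with all its derivatives, let $G(\omega)=g\big((\langle\omega,e_l\rangle)_{l\in\Lambda}\big)$ be the corresponding cylindrical function, and let $DG(\omega)=\sum_{l\in\Lambda}(\partial_l g)\big((\langle\omega,e_j\rangle)_{j\in\Lambda}\big)\,e_l$. Then the sequence $$\big\langle u(\omega_N)\cdot\nabla\omega_N,\,DG\big\rangle=\int_{\mathbb T^2}\big(u(\omega_N)\cdot\nabla\omega_N\big)(x)\,DG(\omega)(x)\,dx,\qquad N\in\mathbb N,$$ lies in $L^p(H^{-1-},\mu)$ and converges in $L^p(H^{-1-},\mu)$ for every $p\in[1,\infty)$; the limit is one and the same function for all $p$. -/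

import Mathlib

open MeasureTheory ProbabilityTheory AddCircle UnitAddTorus Filter Topology
open scoped ENNReal

namespace Vorticity

noncomputable section

/-! ### The torus and its Fourier modes -/

/-- The two-dimensional torus `ℝ² / ℤ²`. -/
abbrev T2 : Type := UnitAddTorus (Fin 2)

/-- Lebesgue measure `dx` on the torus, i.e. Haar measure of total mass one. -/
abbrev torusMeasure : Measure T2 :=
  Measure.pi fun _ : Fin 2 => (haarAddCircle : Measure UnitAddCircle)

/-- The set `ℤ² \ {0}` of frequencies. -/
abbrev Z20 : Type := {k : Fin 2 → ℤ // k ≠ 0}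

/-- The half lattice of those `k ∈ ℤ² \ {0}` with `k₁ > 0`, or `k₁ = 0` and `k₂ > 0`. -/
def IsPlus (k : Z20) : Prop := 0 < k.1 0 ∨ (k.1 0 = 0 ∧ 0 < k.1 1)

/-- `Λ_N = {k ∈ ℤ² \ {0} : max (|k₁|, |k₂|) ≤ N}`. -/
def box (N : ℕ) : Finset Z20 :=
  (Finset.Icc (fun _ => -(N : ℤ)) (fun _ => (N : ℤ)) : Finset (Fin 2 → ℤ)).subtype (fun k => k ≠ 0)

/-- `k^⊥ = (k₂, -k₁)`. -/
def perp (k : Fin 2 → ℤ) : Fin 2 → ℝ := ![(k 1 : ℝ), -(k 0 : ℝ)]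

/-- `|k|² = k₁² + k₂²`. -/
def normSq (k : Fin 2 → ℤ) : ℝ := (k 0 : ℝ) ^ 2 + (k 1 : ℝ) ^ 2

/-! ### Smooth functions on the torus -/

/-- The `ℤ²`-periodic function on `ℝ²` that corresponds to a function on the torus. -/
def lift (φ : T2 → ℝ) (x : Fin 2 → ℝ) : ℝ := φ fun i => (x i : UnitAddCircle)

/-- The space `C^∞(𝕋²)` of real smooth functions on the torus. -/
def smoothFun : Submodule ℝ (T2 → ℝ) where
  carrier := {φ | ContDiff ℝ (⊤ : ℕ∞) (lift φ)}
  add_mem' := fun {a b} (ha : ContDiff ℝ (⊤ : ℕ∞) (lift a)) (hb : ContDiff ℝ (⊤ : ℕ∞) (lift b)) =>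
    ha.add hb
  zero_mem' := (contDiff_const : ContDiff ℝ (⊤ : ℕ∞) fun _ : Fin 2 → ℝ => (0 : ℝ))
  smul_mem' := fun c f (hf : ContDiff ℝ (⊤ : ℕ∞) (lift f)) => hf.const_smul c

/-- The partial derivative `∂_j f` of a function on the torus. -/
def partialDeriv (j : Fin 2) (f : T2 → ℝ) (x : T2) : ℝ :=
  deriv (fun t : ℝ => f (x + Pi.single j (t : UnitAddCircle))) 0

lemma contDiff_mFourier (k : Fin 2 → ℤ) :
    ContDiff ℝ (⊤ : ℕ∞) fun x : Fin 2 → ℝ => mFourier k fun i => (x i : UnitAddCircle) := by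
  have h : (fun x : Fin 2 → ℝ => mFourier k fun i => (x i : UnitAddCircle)) = fun x =>
      ∏ i, Complex.exp (2 * Real.pi * Complex.I * k i * Complex.ofRealCLM (x i)) := by
    ext x
    simp only [mFourier, ContinuousMap.coe_mk, fourier_coe_apply, Complex.ofRealCLM_apply,
      Complex.ofReal_one, div_one]
  rw [h]
  fun_prop

/-- `x ↦ cos (2π k·x)`. -/
def cosFun (k : Fin 2 → ℤ) : smoothFun :=
  ⟨fun x => (mFourier k x).re, Complex.reCLM.contDiff.comp (contDiff_mFourier k)⟩

/-- `x ↦ sin (2π k·x)`. -/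
def sinFun (k : Fin 2 → ℤ) : smoothFun :=
  ⟨fun x => (mFourier k x).im, Complex.imCLM.contDiff.comp (contDiff_mFourier k)⟩

open Classical in
/-- The real orthonormal basis `e_k` of the zero-average part of `L²(𝕋²)`. -/
def realBasis (k : Z20) : smoothFun :=
  Real.sqrt 2 • if IsPlus k then cosFun k.1 else sinFun k.1

/-! ### The space `H^{-1-}` and white noise -/

/-- The space `H^{-1-}(𝕋²) = ⋂_{s > 0} H^{-1-s}(𝕋²)` of real distributions. -/
structure HNegOneMinus where
  /-- The pairing `φ ↦ ⟨ω, φ⟩` with smooth functions. -/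
  pair : smoothFun →ₗ[ℝ] ℝ
  /-- `ω` is a distribution: it is continuous for the topology of uniform convergence of all
  derivatives. -/
  continuous_pair : ∃ (n : ℕ) (C : ℝ), ∀ (φ : smoothFun) (M : ℝ),
    (∀ m ≤ n, ∀ x, ‖iteratedFDeriv ℝ m (lift φ.1) x‖ ≤ M) → |pair φ| ≤ C * M
  /-- `∑_k (1 + |k|²)^{-1-s} |⟨ω, exp(2πi k·)⟩|² < ∞` for every `s > 0`. -/
  sobolev : ∀ s : ℝ, 0 < s → Summable fun k : Fin 2 → ℤ =>
    (1 + normSq k) ^ (-(1 + s)) * (pair (cosFun k) ^ 2 + pair (sinFun k) ^ 2)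

/-- The σ-algebra generated by the evaluations `ω ↦ ⟨ω, φ⟩`; it is the Borel σ-algebra of the
separable Fréchet space `H^{-1-}`. -/
instance : MeasurableSpace HNegOneMinus :=
  ⨆ φ : smoothFun, MeasurableSpace.comap (fun ω => ω.pair φ) inferInstance

/-- `μ` is the law of white noise: `⟨ω, φ⟩` is a centred Gaussian variable of variance
`‖φ‖²` in `L²(𝕋²)`, for every smooth `φ` of zero average (as `φ` varies over a linear space, this
makes the variables jointly Gaussian with covariance the `L²` inner product).  Only zero-average
test functions are asked for, so that both usual conventions for the law of the mean `⟨ω, 1⟩`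
(standard Gaussian, or identically zero) are included. -/
structure IsWhiteNoise (μ : Measure HNegOneMinus) : Prop where
  isProbabilityMeasure : IsProbabilityMeasure μ
  map_pair : ∀ φ : smoothFun, ∫ x, φ.1 x ∂torusMeasure = 0 →
    μ.map (fun ω => ω.pair φ) = gaussianReal 0 (∫ x, φ.1 x ^ 2 ∂torusMeasure).toNNReal

/-! ### The Biot–Savart kernel -/

/-- `K` is an integrable vector field on the torus with Fourier series
`K(x) = 2πi ∑_{k ≠ 0} k^⊥ / |k|² exp(2πi k·x)`.  (For `k = 0` the quotient below is zero.) -/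
structure IsBiotSavartKernel (K : T2 → Fin 2 → ℝ) : Prop where
  integrable : ∀ j, Integrable (fun x => K x j) torusMeasure
  coeff : ∀ (j : Fin 2) (k : Fin 2 → ℤ), mFourierCoeff (fun x => (K x j : ℂ)) k =
      2 * Real.pi * Complex.I * ((perp k j / normSq k : ℝ) : ℂ)

/-! The following lemmas prove that such a kernel exists. -/

/-- One-dimensional Fourier profile: its periodic extension has Fourier coefficients
`n / (m ^ 2 + n ^ 2)`.  Used only to build the Biot–Savart kernel. -/
def prof (n : ℕ) (x : ℝ) : ℝ :=
  Real.pi * (Real.exp (-(2 * Real.pi * n * x)) + Real.exp (-(2 * Real.pi * n * (1 - x)))) /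
    (1 - Real.exp (-(2 * Real.pi * n)))

def profC (n : ℕ) : UnitAddCircle → ℝ := liftIoc 1 0 (prof n)

def wt (x : ℝ) : ℝ := x ^ (-(1 / 2) : ℝ) + (1 - x) ^ (-(1 / 2) : ℝ)

lemma wt_integrable : Integrable (liftIoc 1 0 wt : UnitAddCircle → ℝ) haarAddCircle := by
  have h1 : IntervalIntegrable wt volume 0 1 := by
    have h : IntervalIntegrable (fun x : ℝ => x ^ (-(1 / 2) : ℝ)) volume 0 1 :=
      intervalIntegral.intervalIntegrable_rpow' (by norm_num)
    have h' := (h.comp_sub_left 1).symm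
    simp only [sub_self, sub_zero] at h'
    exact h.add h'
  have h2 : MemLp (fun x => (wt x : ℂ)) 1 (volume.restrict (Set.Ioc (0:ℝ) (0 + 1))) := by
    rw [memLp_one_iff_integrable, zero_add]
    exact ((intervalIntegrable_iff_integrableOn_Ioc_of_le zero_le_one).1 h1).ofReal
  have h3 := h2.memLp_liftIoc
  rw [memLp_one_iff_integrable, volume_eq_smul_haarAddCircle, ENNReal.ofReal_one, one_smul] at h3
  exact h3.re

lemma wt_ge {x : ℝ} (h0 : 0 < x) (h1 : x < 1) : 1 / Real.sqrt (min x (1 - x)) ≤ wt x := by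
  have h2 : 0 < 1 - x := by linarith
  have e : ∀ y : ℝ, 0 < y → y ^ (-(1 / 2) : ℝ) = 1 / Real.sqrt y := by
    intro y hy
    rw [Real.rpow_neg hy.le, Real.sqrt_eq_rpow, one_div, one_div]
  unfold wt
  rw [e x h0, e _ h2]
  rcases min_choice x (1 - x) with h | h <;> rw [h]
  · have : 0 ≤ 1 / Real.sqrt (1 - x) := by positivity
    linarith
  · have : 0 ≤ 1 / Real.sqrt x := by positivity
    linarith

lemma wt_nonneg {x : ℝ} (h0 : 0 < x) (h1 : x < 1) : 0 ≤ wt x :=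
  le_trans (by positivity) (wt_ge h0 h1)

lemma geom_bound {q : ℂ} (hq : ‖q‖ < 1) (N : ℕ) :
    ‖∑ n ∈ Finset.range N, q ^ (n + 1)‖ ≤ 2 / ‖1 - q‖ := by
  have h1 : q ≠ 1 := by rintro rfl; simp at hq
  have h2 : 0 < ‖1 - q‖ := norm_pos_iff.2 (sub_ne_zero.2 (Ne.symm h1))
  simp_rw [pow_succ']
  rw [← Finset.mul_sum, geom_sum_eq h1, norm_mul, norm_div, norm_sub_rev q 1, mul_div_assoc']
  gcongr
  calc ‖q‖ * ‖q ^ N - 1‖ ≤ 1 * (‖q ^ N‖ + ‖(1:ℂ)‖) := by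
        gcongr
        exact norm_sub_le _ _
    _ ≤ 2 := by
        rw [norm_pow, norm_one]
        have : ‖q‖ ^ N ≤ 1 := pow_le_one₀ (norm_nonneg _) hq.le
        linarith

lemma one_sub_exp_ge {x : ℝ} (h0 : 0 < x) (h1 : x < 1) : x / 2 ≤ 1 - Real.exp (-(2 * Real.pi * x)) := by
  have h2 : Real.exp (-(2 * Real.pi * x)) ≤ Real.exp (-x) := by
    apply Real.exp_le_exp.2
    nlinarith [Real.pi_gt_three]
  have h3 : Real.exp (-x) ≤ 1 / (1 + x) := by
    rw [Real.exp_neg, ← one_div]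
    apply one_div_le_one_div_of_le (by linarith)
    linarith [Real.add_one_le_exp x]
  have h4 : 1 / (1 + x) ≤ 1 - x / 2 := by
    rw [div_le_iff₀ (by linarith)]
    nlinarith
  linarith

lemma norm_one_sub_ge {y : ℝ} (h0 : 0 < y) (h1 : y < 1) :
    2 * min y (1 - y) ≤ ‖1 - Complex.exp (2 * Real.pi * Complex.I * y)‖ := by
  have e : (2 * Real.pi * Complex.I * y : ℂ) = Complex.I * ((2 * Real.pi * y : ℝ) : ℂ) := by
    push_cast; ring
  rw [norm_sub_rev, e, Complex.norm_exp_I_mul_ofReal_sub_one]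
  have hpi := Real.pi_pos
  have e2 : 2 * Real.pi * y / 2 = Real.pi * y := by ring
  rw [e2, norm_mul, Real.norm_eq_abs, Real.norm_eq_abs, abs_of_pos (by norm_num : (0:ℝ) < 2)]
  refine mul_le_mul_of_nonneg_left (le_trans ?_ (le_abs_self _)) (by norm_num)
  rcases le_total y (1 / 2) with h | h
  · have := Real.mul_le_sin (x := Real.pi * y) (by positivity) (by nlinarith)
    have e3 : 2 / Real.pi * (Real.pi * y) = 2 * y := by field_simp
    rw [e3] at this
    exact (min_le_left _ _).trans (by linarith)
  · have := Real.mul_le_sin (x := Real.pi * (1 - y)) (by nlinarith) (by nlinarith)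
    have e3 : 2 / Real.pi * (Real.pi * (1 - y)) = 2 * (1 - y) := by field_simp
    have e4 : Real.pi * (1 - y) = Real.pi - Real.pi * y := by ring
    rw [e3, e4, Real.sin_pi_sub] at this
    exact (min_le_right _ _).trans (by linarith)

lemma denom_bound {r a b : ℝ} {z : ℂ} (hz : ‖z‖ = 1) (hr0 : 0 ≤ r) (ha : 0 < a) (hb : 0 < b)
    (hr : a / 2 ≤ 1 - r) (hzb : 2 * b ≤ ‖1 - z‖) (N : ℕ) :
    ‖∑ n ∈ Finset.range N, ((r : ℂ) * z) ^ (n + 1)‖ ≤ 4 * (1 / Real.sqrt a * (1 / Real.sqrt b)) := by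
  have hn : ‖(r : ℂ) * z‖ = r := by
    rw [norm_mul, hz, mul_one, Complex.norm_real, Real.norm_eq_abs, abs_of_nonneg hr0]
  have h1 : 1 - r ≤ ‖1 - (r : ℂ) * z‖ := by
    have := norm_sub_norm_le (1 : ℂ) ((r : ℂ) * z)
    rwa [hn, norm_one] at this
  have h2 : ‖1 - z‖ ≤ 2 * ‖1 - (r : ℂ) * z‖ := by
    have h3 : (1 : ℂ) - z = (1 - (r : ℂ) * z) - ((1 - r : ℝ) : ℂ) * z := by push_cast; ring
    have h4 : ‖((1 - r : ℝ) : ℂ) * z‖ = 1 - r := by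
      rw [norm_mul, hz, mul_one, Complex.norm_real, Real.norm_eq_abs, abs_of_nonneg (by linarith)]
    calc ‖1 - z‖ ≤ ‖1 - (r : ℂ) * z‖ + ‖((1 - r : ℝ) : ℂ) * z‖ := by
          rw [h3]; exact norm_sub_le _ _
      _ ≤ _ := by rw [h4]; linarith
  refine (geom_bound (by rw [hn]; linarith) N).trans ?_
  have hab : 0 < Real.sqrt a * Real.sqrt b := by positivity
  have h5 : Real.sqrt a * Real.sqrt b / 2 ≤ ‖1 - (r : ℂ) * z‖ := by
    rw [← Real.sqrt_mul ha.le]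
    have h6 : Real.sqrt (a * b) ≤ 2 * ‖1 - (r : ℂ) * z‖ := by
      apply Real.sqrt_le_iff.2
      refine ⟨by positivity, ?_⟩
      have i1 : a / 2 ≤ ‖1 - (r : ℂ) * z‖ := by linarith
      have i2 : b ≤ ‖1 - (r : ℂ) * z‖ := by linarith
      nlinarith [mul_le_mul i1 i2 hb.le (norm_nonneg _)]
    linarith
  calc 2 / ‖1 - (r : ℂ) * z‖ ≤ 2 / (Real.sqrt a * Real.sqrt b / 2) := by gcongr
    _ = _ := by field_simp; norm_num

lemma exp_two_pi_le : Real.exp (-(2 * Real.pi)) ≤ 1 / 2 := by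
  have h : (2 : ℝ) ≤ Real.exp (2 * Real.pi) := by
    linarith [Real.add_one_le_exp (2 * Real.pi), Real.pi_gt_three]
  rw [Real.exp_neg, ← one_div]
  exact one_div_le_one_div_of_le (by norm_num) h

lemma prof_eq (n : ℕ) (x : ℝ) : prof n x = Real.pi *
    (Real.exp (-(2 * Real.pi * x)) ^ n + Real.exp (-(2 * Real.pi * (1 - x))) ^ n) /
      (1 - Real.exp (-(2 * Real.pi)) ^ n) := by
  simp only [prof, ← Real.exp_nat_mul]
  congr 2
  · congr 2 <;> ring
  · congr 1; ring

lemma prof_split {x : ℝ} (h0 : 0 < x) (h1 : x < 1) (n : ℕ) :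
    |prof (n + 1) x - Real.pi * (Real.exp (-(2 * Real.pi * x)) ^ (n + 1) +
      Real.exp (-(2 * Real.pi * (1 - x))) ^ (n + 1))| ≤ 4 * Real.pi * (1 / 2) ^ (n + 1) := by
  rw [prof_eq]
  have hpi := Real.pi_pos
  set r := Real.exp (-(2 * Real.pi * x))
  set s := Real.exp (-(2 * Real.pi * (1 - x)))
  set E := Real.exp (-(2 * Real.pi))
  have hr : r ^ (n + 1) ≤ 1 := pow_le_one₀ (Real.exp_pos _).le
    (Real.exp_le_one_iff.2 (by have := mul_pos hpi h0; linarith))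
  have hs : s ^ (n + 1) ≤ 1 := pow_le_one₀ (Real.exp_pos _).le
    (Real.exp_le_one_iff.2 (by have := mul_pos hpi (sub_pos.2 h1); linarith))
  have hr0 : 0 < r ^ (n + 1) := pow_pos (Real.exp_pos _) _
  have hs0 : 0 < s ^ (n + 1) := pow_pos (Real.exp_pos _) _
  have hE0 : 0 < E ^ (n + 1) := pow_pos (Real.exp_pos _) _
  have hE : E ^ (n + 1) ≤ (1 / 2) ^ (n + 1) :=
    pow_le_pow_left₀ (Real.exp_pos _).le exp_two_pi_le _
  have hE2 : E ^ (n + 1) ≤ 1 / 2 := hE.trans (by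
    rw [pow_succ]
    have : ((1:ℝ) / 2) ^ n ≤ 1 := pow_le_one₀ (by norm_num) (by norm_num)
    linarith)
  have e : Real.pi * (r ^ (n + 1) + s ^ (n + 1)) / (1 - E ^ (n + 1)) -
      Real.pi * (r ^ (n + 1) + s ^ (n + 1)) =
      Real.pi * (r ^ (n + 1) + s ^ (n + 1)) * E ^ (n + 1) / (1 - E ^ (n + 1)) := by
    have : 1 - E ^ (n + 1) ≠ 0 := by linarith
    field_simp; ring
  have hd : 0 < 1 - E ^ (n + 1) := by linarith
  rw [e, abs_of_nonneg (by positivity), div_le_iff₀ hd]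
  calc Real.pi * (r ^ (n + 1) + s ^ (n + 1)) * E ^ (n + 1) ≤ Real.pi * (1 + 1) * (1 / 2) ^ (n + 1) := by
        gcongr
    _ = 4 * Real.pi * (1 / 2) ^ (n + 1) * (1 / 2) := by ring
    _ ≤ _ := by gcongr; linarith

lemma geom_half (N : ℕ) : ∑ n ∈ Finset.range N, (1 / 2 : ℝ) ^ (n + 1) ≤ 1 := by
  have h : ∑ n ∈ Finset.range N, (1 / 2 : ℝ) ^ (n + 1) = 1 - (1 / 2) ^ N := by
    induction N with
    | zero => simp
    | succ k ih => rw [Finset.sum_range_succ, ih]; ring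
  rw [h]
  have : (0:ℝ) ≤ (1 / 2) ^ N := by positivity
  linarith

lemma partial_bound {x y : ℝ} (h0 : 0 < x) (h1 : x < 1) (k0 : 0 < y) (k1 : y < 1) (N : ℕ) :
    |∑ n ∈ Finset.range N, prof (n + 1) x * (Complex.exp (2 * Real.pi * Complex.I * y) ^ (n + 1)).im| ≤
      4 * Real.pi + 8 * Real.pi * (wt x * wt y) := by
  have hpi := Real.pi_pos
  set r := Real.exp (-(2 * Real.pi * x)) with hr
  set s := Real.exp (-(2 * Real.pi * (1 - x))) with hs
  set z := Complex.exp (2 * Real.pi * Complex.I * y) with hz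
  have hz1 : ‖z‖ = 1 := by
    have e : (2 * Real.pi * Complex.I * y : ℂ) = ((2 * Real.pi * y : ℝ) : ℂ) * Complex.I := by
      push_cast; ring
    rw [hz, e, Complex.norm_exp_ofReal_mul_I]
  have x1 : 0 < 1 - x := by linarith
  have y1 : 0 < 1 - y := by linarith
  have hm : 0 < min x (1 - x) := lt_min h0 x1
  have hmy : 0 < min y (1 - y) := lt_min k0 y1
  have B1 := denom_bound (r := r) hz1 (Real.exp_pos _).le hm hmy
    ((by linarith [min_le_left x (1 - x)] : _ ≤ x / 2).trans (one_sub_exp_ge h0 h1))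
    (norm_one_sub_ge k0 k1) N
  have B2 := denom_bound (r := s) hz1 (Real.exp_pos _).le hm hmy
    ((by linarith [min_le_right x (1 - x)] : _ ≤ (1 - x) / 2).trans
      (one_sub_exp_ge x1 (by linarith)))
    (norm_one_sub_ge k0 k1) N
  have hw : 1 / Real.sqrt (min x (1 - x)) * (1 / Real.sqrt (min y (1 - y))) ≤ wt x * wt y :=
    mul_le_mul (wt_ge h0 h1) (wt_ge k0 k1) (by positivity) (wt_nonneg h0 h1)
  have split : ∑ n ∈ Finset.range N, prof (n + 1) x * (z ^ (n + 1)).im =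
      ∑ n ∈ Finset.range N, (prof (n + 1) x - Real.pi * (r ^ (n + 1) + s ^ (n + 1))) *
        (z ^ (n + 1)).im +
      (Real.pi * (∑ n ∈ Finset.range N, ((r : ℂ) * z) ^ (n + 1)).im +
       Real.pi * (∑ n ∈ Finset.range N, ((s : ℂ) * z) ^ (n + 1)).im) := by
    rw [Complex.im_sum, Complex.im_sum, Finset.mul_sum, Finset.mul_sum, ← Finset.sum_add_distrib,
      ← Finset.sum_add_distrib]
    refine Finset.sum_congr rfl fun n _ => ?_
    have e : ∀ t : ℝ, (((t : ℂ) * z) ^ (n + 1)).im = t ^ (n + 1) * (z ^ (n + 1)).im := by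
      intro t
      rw [mul_pow, ← Complex.ofReal_pow, Complex.im_ofReal_mul]
    rw [e, e]; ring
  rw [split]
  have C0 : |∑ n ∈ Finset.range N, (prof (n + 1) x - Real.pi * (r ^ (n + 1) + s ^ (n + 1))) *
        (z ^ (n + 1)).im| ≤ 4 * Real.pi := by
    calc _ ≤ ∑ n ∈ Finset.range N, 4 * Real.pi * (1 / 2) ^ (n + 1) := by
          refine (Finset.abs_sum_le_sum_abs _ _).trans (Finset.sum_le_sum fun n _ => ?_)
          rw [abs_mul]
          have i1 : |(z ^ (n + 1)).im| ≤ 1 := by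
            refine (Complex.abs_im_le_norm _).trans ?_
            rw [norm_pow, hz1, one_pow]
          have i2 := prof_split h0 h1 n
          calc _ ≤ 4 * Real.pi * (1 / 2) ^ (n + 1) * 1 := by gcongr
            _ = _ := mul_one _
      _ = 4 * Real.pi * ∑ n ∈ Finset.range N, (1 / 2) ^ (n + 1) := by rw [Finset.mul_sum]
      _ ≤ 4 * Real.pi * 1 := by gcongr; exact geom_half N
      _ = _ := mul_one _
  have C : ∀ t : ℝ, ‖∑ n ∈ Finset.range N, ((t : ℂ) * z) ^ (n + 1)‖ ≤
      4 * (1 / Real.sqrt (min x (1 - x)) * (1 / Real.sqrt (min y (1 - y)))) →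
      |Real.pi * (∑ n ∈ Finset.range N, ((t : ℂ) * z) ^ (n + 1)).im| ≤ 4 * Real.pi * (wt x * wt y) := by
    intro t ht
    rw [abs_mul, abs_of_pos hpi]
    have := (Complex.abs_im_le_norm _).trans ht
    calc _ ≤ Real.pi * (4 * (wt x * wt y)) := by gcongr; linarith
      _ = _ := by ring
  have := abs_add_le (∑ n ∈ Finset.range N, (prof (n + 1) x - Real.pi * (r ^ (n + 1) + s ^ (n + 1))) *
        (z ^ (n + 1)).im) (Real.pi * (∑ n ∈ Finset.range N, ((r : ℂ) * z) ^ (n + 1)).im +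
       Real.pi * (∑ n ∈ Finset.range N, ((s : ℂ) * z) ^ (n + 1)).im)
  have := abs_add_le (Real.pi * (∑ n ∈ Finset.range N, ((r : ℂ) * z) ^ (n + 1)).im)
       (Real.pi * (∑ n ∈ Finset.range N, ((s : ℂ) * z) ^ (n + 1)).im)
  have := C r B1
  have := C s B2
  linarith

lemma partial_summable {x : ℝ} (h0 : 0 < x) (h1 : x < 1) {z : ℂ} (hz1 : ‖z‖ = 1) :
    Summable fun n : ℕ => 2 * (prof (n + 1) x * (z ^ (n + 1)).im) := by
  have hpi := Real.pi_pos
  set r := Real.exp (-(2 * Real.pi * x)) with hr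
  set s := Real.exp (-(2 * Real.pi * (1 - x))) with hs
  have hr1 : r < 1 := Real.exp_lt_one_iff.2 (by have := mul_pos hpi h0; linarith)
  have hs1 : s < 1 := Real.exp_lt_one_iff.2 (by have := mul_pos hpi (sub_pos.2 h1); linarith)
  have hr0 : 0 < r := Real.exp_pos _
  have hs0 : 0 < s := Real.exp_pos _
  have sr := (summable_nat_add_iff 1).2 (summable_geometric_of_lt_one hr0.le hr1)
  have ss := (summable_nat_add_iff 1).2 (summable_geometric_of_lt_one hs0.le hs1)
  have sh := (summable_nat_add_iff 1).2
    (summable_geometric_of_lt_one (by norm_num : (0:ℝ) ≤ 1 / 2) (by norm_num))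
  refine Summable.mul_left _ (Summable.of_norm_bounded
    (((sr.add ss).mul_left Real.pi).add (sh.mul_left (4 * Real.pi))) fun n => ?_)
  rw [norm_mul, Real.norm_eq_abs, Real.norm_eq_abs]
  have i1 : |(z ^ (n + 1)).im| ≤ 1 := by
    refine (Complex.abs_im_le_norm _).trans ?_
    rw [norm_pow, hz1, one_pow]
  have i2 := prof_split h0 h1 n
  have i3 : |prof (n + 1) x| ≤ Real.pi * (r ^ (n + 1) + s ^ (n + 1)) + 4 * Real.pi * (1 / 2) ^ (n + 1) := by
    have p : 0 ≤ Real.pi * (r ^ (n + 1) + s ^ (n + 1)) := by positivity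
    have := abs_add_le (prof (n + 1) x - Real.pi * (r ^ (n + 1) + s ^ (n + 1)))
      (Real.pi * (r ^ (n + 1) + s ^ (n + 1)))
    rw [sub_add_cancel, abs_of_nonneg p] at this
    linarith
  calc _ ≤ |prof (n + 1) x| * 1 := by gcongr
    _ ≤ _ := by rw [mul_one]; exact i3

lemma coeff_profC (n : ℕ) (hn : n ≠ 0) (m : ℤ) :
    fourierCoeff (fun x => (profC n x : ℂ)) m = (n : ℂ) / ((m : ℂ) ^ 2 + (n : ℂ) ^ 2) := by
  have h1 : (fun x => (profC n x : ℂ)) = liftIoc 1 0 (fun x => (prof n x : ℂ)) := by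
    ext x; rfl
  have hpi : (Real.pi : ℂ) ≠ 0 := by exact_mod_cast Real.pi_ne_zero
  have hn' : (n : ℂ) ≠ 0 := by exact_mod_cast hn
  rw [h1, fourierCoeff_liftIoc_eq, fourierCoeffOn_eq_integral]
  have hA : (n : ℂ) + Complex.I * m ≠ 0 := by
    intro h
    have := congrArg Complex.re h
    simp at this
    exact hn (by exact_mod_cast this)
  have hB : (n : ℂ) - Complex.I * m ≠ 0 := by
    intro h
    have := congrArg Complex.re h
    simp at this
    exact hn (by exact_mod_cast this)
  set E : ℂ := Complex.exp (-(2 * Real.pi * n)) with hE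
  have hE1 : 1 - E ≠ 0 := by
    have : (1 - Real.exp (-(2 * Real.pi * n)) : ℝ) ≠ 0 := by
      have : Real.exp (-(2 * Real.pi * n)) < 1 := by
        rw [Real.exp_lt_one_iff]
        have : (0:ℝ) < n := by exact_mod_cast Nat.pos_of_ne_zero hn
        have := Real.pi_pos
        simp only [Left.neg_neg_iff]; positivity
      linarith
    rw [hE]
    exact_mod_cast this
  have key : ∀ x : ℝ, (fourier (-m) (x : AddCircle ((0:ℝ) + 1 - 0)) : ℂ) • (prof n x : ℂ) =
      Real.pi / (1 - E) * (Complex.exp (-(2 * Real.pi * (n + Complex.I * m)) * x) +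
        E * Complex.exp ((2 * Real.pi * (n - Complex.I * m)) * x)) := by
    intro x
    rw [fourier_coe_apply]
    simp only [prof, smul_eq_mul, hE]
    push_cast
    rw [← Complex.exp_add]
    have q1 : 2 * (Real.pi : ℂ) * Complex.I * -(m : ℂ) * x / (0 + 1 - 0) + -(2 * Real.pi * n * x) =
        -(2 * Real.pi * (n + Complex.I * m)) * x := by
      rw [zero_add, sub_zero, div_one]; ring
    have q2 : 2 * (Real.pi : ℂ) * Complex.I * -(m : ℂ) * x / (0 + 1 - 0) +
        -(2 * Real.pi * n * (1 - x)) =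
        -(2 * Real.pi * n) + (2 * Real.pi * (n - Complex.I * m)) * x := by
      rw [zero_add, sub_zero, div_one]; ring
    rw [← q1, ← q2, Complex.exp_add, Complex.exp_add]
    ring
  simp_rw [key]
  rw [intervalIntegral.integral_const_mul, intervalIntegral.integral_add, intervalIntegral.integral_const_mul,
    integral_exp_mul_complex, integral_exp_mul_complex]
  · have e1 : Complex.exp (-(2 * Real.pi * (n + Complex.I * m))) = E := by
      rw [hE, Complex.exp_eq_exp_iff_exists_int]
      exact ⟨-m, by push_cast; ring⟩
    have e2 : E * Complex.exp ((2 * Real.pi * (n - Complex.I * m))) = 1 := by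
      rw [hE, ← Complex.exp_add, Complex.exp_eq_one_iff]
      exact ⟨-m, by push_cast; ring⟩
    have : ((m : ℂ) ^ 2 + (n : ℂ) ^ 2) = (n + Complex.I * m) * (n - Complex.I * m) := by
      ring_nf; rw [Complex.I_sq]; ring
    rw [this]
    simp only [zero_add, Complex.ofReal_one, mul_one, Complex.ofReal_zero, mul_zero, Complex.exp_zero]
    rw [e1]
    rw [mul_div_assoc', mul_sub, e2]
    field_simp
    have hE' : 1 - E ≠ 0 := hE1
    simp only [sub_zero, div_one, one_smul]
    field_simp
    ring
  · simpa [hpi] using hB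
  · simpa [hpi] using hA
  · exact (by fun_prop : Continuous _).intervalIntegrable _ _
  · exact (by fun_prop : Continuous _).intervalIntegrable _ _

def pterm (n : ℕ) (p : T2) : ℝ :=
  2 * (profC (n + 1) (p 0) * (fourier (1 : ℤ) (p 1) ^ (n + 1) : ℂ).im)

lemma measurable_profC (n : ℕ) : Measurable (profC n) := by
  have h : Measurable (prof n) := by unfold prof; fun_prop
  exact (h.comp measurable_subtype_coe).comp (AddCircle.measurableEquivIoc 1 0).measurable

lemma measurable_pterm (n : ℕ) : Measurable (pterm n) := by
  have h1 := measurable_profC (n + 1)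
  have h2 : Measurable (fun p : T2 => (fourier (1 : ℤ) (p 1) ^ (n + 1) : ℂ).im) := by
    apply Continuous.measurable
    fun_prop
  unfold pterm
  exact ((h1.comp (measurable_pi_apply 0)).mul h2).const_mul 2

lemma ae_torus : ∀ᵐ p ∂torusMeasure, ∃ x y : ℝ, 0 < x ∧ x < 1 ∧ 0 < y ∧ y < 1 ∧
    p 0 = (x : UnitAddCircle) ∧ p 1 = (y : UnitAddCircle) := by
  have h0 : ∀ᵐ u ∂(haarAddCircle : Measure UnitAddCircle), ∃ x : ℝ, 0 < x ∧ x < 1 ∧ u = (x : UnitAddCircle) := by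
    have hv : (volume : Measure UnitAddCircle) = haarAddCircle := by
      rw [volume_eq_smul_haarAddCircle, ENNReal.ofReal_one, one_smul]
    have hz : (volume : Measure UnitAddCircle) {0} = 0 := by
      have := AddCircle.volume_closedBall 1 (x := (0 : UnitAddCircle)) 0
      simpa using this
    rw [← hv]
    have hae : ∀ᵐ u ∂(volume : Measure UnitAddCircle), u ≠ 0 := by
      rw [ae_iff]; simpa using hz
    filter_upwards [hae] with u hu
    have h2 := (equivIoc 1 0 u).2
    have h3 : ((equivIoc 1 0 u : ℝ) : UnitAddCircle) = u := (equivIoc 1 0).symm_apply_apply u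
    refine ⟨equivIoc 1 0 u, h2.1, lt_of_le_of_ne (h2.2.trans_eq (zero_add 1)) fun h => hu ?_, h3.symm⟩
    rw [← h3, h]
    exact AddCircle.coe_period 1
  have e := fun i : Fin 2 => (Measure.quasiMeasurePreserving_eval
    (μ := fun _ : Fin 2 => (haarAddCircle : Measure UnitAddCircle)) i).ae h0
  filter_upwards [e 0, e 1] with p ⟨x, hx0, hx1, hx⟩ ⟨y, hy0, hy1, hy⟩
  exact ⟨x, y, hx0, hx1, hy0, hy1, hx, hy⟩

lemma profC_coe {x : ℝ} (h0 : 0 < x) (h1 : x < 1) (n : ℕ) : profC n (x : UnitAddCircle) = prof n x :=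
  liftIoc_zero_coe_apply ⟨h0, h1.le⟩

lemma fourier_one_coe (y : ℝ) : (fourier (1 : ℤ) (y : UnitAddCircle) : ℂ) =
    Complex.exp (2 * Real.pi * Complex.I * y) := by
  rw [fourier_coe_apply]; simp

lemma integrable_dom : Integrable (fun p : T2 => 8 * Real.pi + 16 * Real.pi *
    (liftIoc 1 0 wt (p 0 : UnitAddCircle) * liftIoc 1 0 wt (p 1 : UnitAddCircle))) torusMeasure := by
  have h := Integrable.fintype_prod (ι := Fin 2) (𝕜 := ℝ) (μ := fun _ => (haarAddCircle : Measure UnitAddCircle))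
    (f := fun _ => (liftIoc 1 0 wt : UnitAddCircle → ℝ)) (fun _ => wt_integrable)
  simp only [Fin.prod_univ_two] at h
  exact (integrable_const _).add (h.const_mul _)

lemma coeff_im (n : ℕ) (m : ℤ) :
    fourierCoeff (fun u : UnitAddCircle => (((fourier (1 : ℤ) u ^ (n + 1) : ℂ).im : ℝ) : ℂ)) m =
      ((if m = (n + 1 : ℕ) then 1 else 0) - (if m = -(n + 1 : ℕ) then 1 else 0)) / (2 * Complex.I) := by
  have e : (fun u : UnitAddCircle => (((fourier (1 : ℤ) u ^ (n + 1) : ℂ).im : ℝ) : ℂ)) =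
      fun u => (1 / (2 * Complex.I)) * (fourier ((n + 1 : ℕ) : ℤ) u + (-1) * fourier (-((n + 1 : ℕ) : ℤ)) u) := by
    ext u
    have : (fourier (1 : ℤ) u ^ (n + 1) : ℂ) = fourier ((n + 1 : ℕ) : ℤ) u := by
      rw [fourier_apply, fourier_apply, one_zsmul, natCast_zsmul, toCircle_nsmul]; simp
    rw [this, fourier_neg, Complex.im_eq_sub_conj]
    ring
  rw [e, fourierCoeff.const_mul]
  have hc : ∀ g : UnitAddCircle → ℂ, Continuous g → Integrable g haarAddCircle := fun g hg =>
    hg.integrable_of_hasCompactSupport (HasCompactSupport.of_compactSpace _)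
  have add := fourierCoeff.add (T := 1) (f := fun u => (fourier ((n + 1 : ℕ) : ℤ) u : ℂ))
    (g := fun u => (-1) * (fourier (-((n + 1 : ℕ) : ℤ)) u : ℂ))
    (hc _ (by fun_prop)) (hc _ (by fun_prop))
  have add' := congrFun add m
  simp only [Pi.add_apply] at add'
  rw [show (fun u : UnitAddCircle => (fourier ((n + 1 : ℕ) : ℤ) u + (-1) * fourier (-((n + 1 : ℕ) : ℤ)) u : ℂ)) =
    (fun u => (fourier ((n + 1 : ℕ) : ℤ) u : ℂ)) + fun u => (-1) * (fourier (-((n + 1 : ℕ) : ℤ)) u : ℂ) from rfl,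
    add', fourierCoeff.const_mul]
  rw [fourierCoeff_fourier, fourierCoeff_fourier]
  simp only [Pi.single_apply]
  ring

lemma coeff_pterm (n : ℕ) (k : Fin 2 → ℤ) :
    mFourierCoeff (fun p => (pterm n p : ℂ)) k =
      2 * (((n + 1 : ℕ) : ℂ) / ((k 0 : ℂ) ^ 2 + ((n + 1 : ℕ) : ℂ) ^ 2) *
      (((if k 1 = (n + 1 : ℕ) then 1 else 0) - (if k 1 = -(n + 1 : ℕ) then 1 else 0)) / (2 * Complex.I))) := by
  rw [← coeff_profC (n + 1) (by omega), ← coeff_im]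
  have h := integral_fintype_prod_eq_prod (ι := Fin 2) (𝕜 := ℂ) (μ := fun _ => (haarAddCircle : Measure UnitAddCircle))
    (![fun u => fourier (-(k 0)) u • (profC (n + 1) u : ℂ),
       fun u => fourier (-(k 1)) u • (((fourier (1 : ℤ) u ^ (n + 1) : ℂ).im : ℝ) : ℂ)])
  simp only [Fin.prod_univ_two, Matrix.cons_val_zero, Matrix.cons_val_one] at h
  unfold fourierCoeff
  rw [← h, ← integral_const_mul]
  refine integral_congr_ae (Filter.Eventually.of_forall fun p => ?_)
  simp only [pterm, mFourier, ContinuousMap.coe_mk, Fin.prod_univ_two, smul_eq_mul, Pi.neg_apply]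
  push_cast
  ring

lemma exists_half_kernel : ∃ f : T2 → ℝ, Integrable f torusMeasure ∧ ∀ k : Fin 2 → ℤ,
    mFourierCoeff (fun p => (f p : ℂ)) k =
      -Complex.I * (k 1 : ℂ) / ((k 0 : ℂ) ^ 2 + (k 1 : ℂ) ^ 2) := by
  have hbd : ∀ N : ℕ, ∀ᵐ p ∂torusMeasure, ‖∑ n ∈ Finset.range N, pterm n p‖ ≤ 8 * Real.pi +
      16 * Real.pi * (liftIoc 1 0 wt (p 0 : UnitAddCircle) * liftIoc 1 0 wt (p 1 : UnitAddCircle)) := by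
    intro N
    filter_upwards [ae_torus] with p ⟨x, y, hx0, hx1, hy0, hy1, hx, hy⟩
    have := partial_bound hx0 hx1 hy0 hy1 N
    simp only [pterm, hx, hy, profC_coe hx0 hx1, fourier_one_coe, ← Finset.mul_sum]
    rw [liftIoc_zero_coe_apply ⟨hx0, hx1.le⟩, liftIoc_zero_coe_apply ⟨hy0, hy1.le⟩, norm_mul,
      Real.norm_eq_abs, Real.norm_eq_abs, abs_of_pos (by norm_num : (0:ℝ) < 2)]
    linarith
  have hlim : ∀ᵐ p ∂torusMeasure, Filter.Tendsto (fun N => ∑ n ∈ Finset.range N, pterm n p)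
      Filter.atTop (nhds (∑' n, pterm n p)) := by
    filter_upwards [ae_torus] with p ⟨x, y, hx0, hx1, hy0, hy1, hx, hy⟩
    have hz : ‖Complex.exp (2 * Real.pi * Complex.I * y)‖ = 1 := by
      have e : (2 * Real.pi * Complex.I * y : ℂ) = ((2 * Real.pi * y : ℝ) : ℂ) * Complex.I := by
        push_cast; ring
      rw [e, Complex.norm_exp_ofReal_mul_I]
    have hs : Summable fun n => pterm n p := by
      have := partial_summable hx0 hx1 hz
      simpa only [pterm, hx, hy, profC_coe hx0 hx1, fourier_one_coe] using this
    exact hs.hasSum.tendsto_sum_nat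
  have hmeas : ∀ N : ℕ, AEStronglyMeasurable (fun p => ∑ n ∈ Finset.range N, pterm n p) torusMeasure :=
    fun N => (Finset.measurable_sum _ fun n _ => measurable_pterm n).aestronglyMeasurable
  have hfm := aestronglyMeasurable_of_tendsto_ae Filter.atTop hmeas hlim
  have hint : ∀ N : ℕ, Integrable (fun p => ∑ n ∈ Finset.range N, pterm n p) torusMeasure :=
    fun N => Integrable.mono' integrable_dom (hmeas N) (hbd N)
  refine ⟨fun p => ∑' n, pterm n p, ?_, ?_⟩
  · refine Integrable.mono' integrable_dom hfm ?_
    filter_upwards [hlim, ae_all_iff.2 hbd] with p h1 h2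
    exact le_of_tendsto h1.norm (Filter.Eventually.of_forall h2)
  · intro k
    have hD : Filter.Tendsto (fun N => mFourierCoeff
        (fun p => ((∑ n ∈ Finset.range N, pterm n p : ℝ) : ℂ)) k) Filter.atTop
        (nhds (mFourierCoeff (fun p => ((∑' n, pterm n p : ℝ) : ℂ)) k)) := by
      refine tendsto_integral_of_dominated_convergence (μ := torusMeasure) _ (fun N => ?_)
        integrable_dom (fun N => ?_) ?_
      · exact (mFourier (-k)).continuous.aestronglyMeasurable.smul
          (Complex.continuous_ofReal.comp_aestronglyMeasurable (hmeas N))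
      · filter_upwards [hbd N] with p hp
        rw [norm_smul, Complex.norm_real]
        refine le_trans ?_ hp
        have : ‖mFourier (-k) p‖ ≤ 1 := (ContinuousMap.norm_coe_le_norm _ p).trans mFourier_norm.le
        calc _ ≤ 1 * ‖∑ n ∈ Finset.range N, pterm n p‖ := by gcongr
          _ = _ := one_mul _
      · filter_upwards [hlim] with p hp
        exact ((Complex.continuous_ofReal.tendsto _).comp hp).const_smul _
    refine tendsto_nhds_unique hD (tendsto_const_nhds.congr' ?_)
    filter_upwards [Filter.eventually_ge_atTop (k 1).natAbs] with N hN
    have hsum : mFourierCoeff (fun p => ((∑ n ∈ Finset.range N, pterm n p : ℝ) : ℂ)) k =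
        ∑ n ∈ Finset.range N, mFourierCoeff (fun p => (pterm n p : ℂ)) k := by
      unfold mFourierCoeff
      refine Eq.trans ?_ (integral_finsetSum (μ := torusMeasure) _ ?_)
      · refine integral_congr_ae (Filter.Eventually.of_forall fun p => ?_)
        simp only [smul_eq_mul]
        push_cast
        rw [Finset.mul_sum]
      · intro n _
        have hi : Integrable (pterm n) torusMeasure := by
          have := (hint (n + 1)).sub (hint n)
          refine this.congr (Filter.Eventually.of_forall fun p => ?_)
          simp [Finset.sum_range_succ]
        refine hi.ofReal.bdd_mul (c := 1) (mFourier (-k)).continuous.aestronglyMeasurable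
          (Filter.Eventually.of_forall fun p => ?_)
        exact (ContinuousMap.norm_coe_le_norm _ p).trans mFourier_norm.le
    rw [hsum]
    simp_rw [coeff_pterm]
    rcases lt_trichotomy (k 1) 0 with h | h | h
    · obtain ⟨j, hj⟩ : ∃ j : ℕ, k 1 = -(j + 1 : ℕ) := ⟨(k 1).natAbs - 1, by omega⟩
      rw [Finset.sum_eq_single j]
      · rw [if_neg (by omega), if_pos hj, hj]
        push_cast
        ring_nf
        simp
        ring
      · intro b _ hb
        rw [if_neg (by omega), if_neg (by omega)]
        simp
      · intro hh
        exact absurd (Finset.mem_range.2 (by omega)) hh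
    · rw [h]
      rw [Finset.sum_eq_zero]
      · simp
      · intro b _
        rw [if_neg (by omega), if_neg (by omega)]
        simp
    · obtain ⟨j, hj⟩ : ∃ j : ℕ, k 1 = (j + 1 : ℕ) := ⟨(k 1).natAbs - 1, by omega⟩
      rw [Finset.sum_eq_single j]
      · rw [if_pos hj, if_neg (by omega), hj]
        push_cast
        ring_nf
        simp
        ring
      · intro b _ hb
        rw [if_neg (by omega), if_neg (by omega)]
        simp
      · intro hh
        exact absurd (Finset.mem_range.2 (by omega)) hh

theorem exists_isBiotSavartKernel : ∃ K : T2 → Fin 2 → ℝ, IsBiotSavartKernel K := by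
  obtain ⟨f, hf, hc⟩ := exists_half_kernel
  let s : T2 → T2 := MeasurableEquiv.arrowCongr' (Equiv.swap (0 : Fin 2) 1) (MeasurableEquiv.refl UnitAddCircle)
  have hs : MeasurePreserving s torusMeasure torusMeasure :=
    measurePreserving_arrowCongr' _ _ (Equiv.swap (0 : Fin 2) 1) (MeasurableEquiv.refl UnitAddCircle)
      (fun _ => MeasurePreserving.id _)
  have he : MeasurableEmbedding s := MeasurableEquiv.measurableEmbedding _
  have s0 : ∀ p, s p 0 = p 1 := fun p => rfl
  have s1 : ∀ p, s p 1 = p 0 := fun p => rfl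
  have hfs : Integrable (fun p => f (s p)) torusMeasure := hs.integrable_comp_of_integrable hf
  have hcs : ∀ k : Fin 2 → ℤ, mFourierCoeff (fun p => (f (s p) : ℂ)) k =
      -Complex.I * (k 0 : ℂ) / ((k 1 : ℂ) ^ 2 + (k 0 : ℂ) ^ 2) := by
    intro k
    have h1 := hc ![k 1, k 0]
    simp only [Matrix.cons_val_zero, Matrix.cons_val_one] at h1
    rw [← h1]
    unfold mFourierCoeff
    refine Eq.trans ?_ (hs.integral_comp he
      (fun p => mFourier (-![k 1, k 0]) p • (f p : ℂ)))
    refine integral_congr_ae (Filter.Eventually.of_forall fun p => ?_)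
    simp only [mFourier, ContinuousMap.coe_mk, Fin.prod_univ_two, Pi.neg_apply, s0, s1,
      Matrix.cons_val_zero, Matrix.cons_val_one, smul_eq_mul]
    ring
  have mul : ∀ (c : ℝ) (g : T2 → ℝ) (k : Fin 2 → ℤ),
      mFourierCoeff (fun p => ((c * g p : ℝ) : ℂ)) k = c * mFourierCoeff (fun p => (g p : ℂ)) k := by
    intro c g k
    unfold mFourierCoeff
    rw [← integral_const_mul]
    refine integral_congr_ae (Filter.Eventually.of_forall fun p => ?_)
    simp only [smul_eq_mul]
    push_cast
    ring
  refine ⟨fun p => ![-(2 * Real.pi) * f p, 2 * Real.pi * f (s p)], ⟨fun j => ?_, fun j k => ?_⟩⟩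
  · fin_cases j
    · exact hf.const_mul _
    · exact hfs.const_mul _
  · fin_cases j
    · refine (mul _ f k).trans ?_
      rw [hc]
      simp [perp, normSq]
      ring
    · refine (mul _ (fun p => f (s p)) k).trans ?_
      rw [hcs]
      simp [perp, normSq]
      ring

/-- The Biot–Savart kernel `K`: the integrable vector field with the Fourier series above (it is
unique up to a null set). -/
def biotSavartKernel : T2 → Fin 2 → ℝ := Classical.choose exists_isBiotSavartKernel

/-- The kernel has the prescribed Fourier series. -/
theorem isBiotSavartKernel_biotSavartKernel : IsBiotSavartKernel biotSavartKernel :=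
  Classical.choose_spec exists_isBiotSavartKernel

/-- The Biot–Savart law `u(f)(x) = ∫ K(x - y) f(y) dy`. -/
def velocity (f : T2 → ℝ) (x : T2) (j : Fin 2) : ℝ :=
  ∫ y, biotSavartKernel (x - y) j * f y ∂torusMeasure

/-! ### Cylindrical functions and the Galerkin drift -/

/-- The projection `ω_N = Π_N ω = ∑_{k ∈ Λ_N} ⟨ω, e_k⟩ e_k`. -/
def galerkinProj (N : ℕ) (ω : HNegOneMinus) : smoothFun :=
  ∑ k ∈ box N, ω.pair (realBasis k) • realBasis k

/-- The coordinates `(⟨ω, e_l⟩)_{l ∈ Λ}` of `Π_Λ ω` in `ℝ^Λ`. -/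
def coords (Λ : Finset Z20) (ω : HNegOneMinus) : Λ → ℝ := fun l => ω.pair (realBasis l.1)

/-- The gradient `DG(ω) = ∑_{l ∈ Λ} (∂_l g)(Π_Λ ω) e_l` of the cylindrical function
`G = g ∘ Π_Λ`. -/
def cylGradient (Λ : Finset Z20) (g : (Λ → ℝ) → ℝ) (ω : HNegOneMinus) : smoothFun :=
  ∑ l : Λ, fderiv ℝ g (coords Λ ω) (Pi.single l 1) • realBasis l.1

/-- The Galerkin drift term `⟨u(ω_N)·∇ω_N, DG⟩` as a function of `ω`, with `G = g ∘ Π_Λ`. -/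
def galerkinDrift (Λ : Finset Z20) (g : (Λ → ℝ) → ℝ) (N : ℕ) (ω : HNegOneMinus) : ℝ :=
  ∫ x, (∑ j : Fin 2, velocity (galerkinProj N ω).1 x j * partialDeriv j (galerkinProj N ω).1 x) *
    (cylGradient Λ g ω).1 x ∂torusMeasure

end

end Vorticity

open Vorticity

/-! Since the factors `∂_l g` do not depend on `x`, the drift is a finite sum of products `∂_l g ·
Q_{l,N}`, where `Q_{l,N}` is a quadratic form in the Fourier coordinates of `ω`. Under white noise
these coordinates are independent standard Gaussians. The advection term fixes the form only up to
symmetrisation. As `k^⊥ · m` is antisymmetric, symmetrising replaces `1/|k|²` by half of `1/|k|² -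
1/|m|²`.

This cancellation has two effects. The diagonal vanishes, so the forms are trace-free and no
divergent constant has to be subtracted. The coefficients also gain one power of decay: a
coefficient is nonzero only if `l = ±k ± m`, where `k` and `m` have almost equal length, and its
size is then at most of order `|l|²/(|k||m|)` instead of `|l|/|k|`. In dimension two the former is
square summable along this constraint (`cross_sq_mul_sq_le`, `summable_driftCoeff_sq`), while the
bound `|l|/|k|` just fails to be.

For a trace-free Gaussian quadratic form every moment is controlled by the Hilbert–Schmidt norm of
its matrix: diagonalise, factor the exponential moment by independence, and note that the
first-order terms add up to the trace (`lintegral_quadratic_pow_le`). The difference of two Galerkin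
forms has the tail of a convergent series as its squared Hilbert–Schmidt norm, so `Q_{l,N}` is
Cauchy in every `L^p`. Hölder's inequality with `∂_l g ∈ L^{2p}` carries this over to the drift.
Limits for different `p` agree because each is also a limit in measure. -/

namespace Vorticity

/-! ### Quadratic forms in a finite family of independent standard Gaussians -/

section Gaussian

variable {Ω ι : Type*} [MeasurableSpace Ω] [Fintype ι]

/-- A finite family of real random variables that are independent standard Gaussians, expressed
through the laws of their linear combinations. -/
structure IsStdGaussianFamily (X : ι → Ω → ℝ) (P : Measure Ω) : Prop where
  measurable : ∀ i, Measurable (X i)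
  map_sum : ∀ c : ι → ℝ, P.map (fun ω => ∑ i, c i * X i ω) =
    gaussianReal 0 (∑ i, c i ^ 2).toNNReal

namespace IsStdGaussianFamily

variable {X : ι → Ω → ℝ} {P : Measure Ω}

/-- The coefficients `c = 0` suffice: pushing forward preserves total mass, and the law of the zero
combination has mass one. -/
lemma isProbabilityMeasure (h : IsStdGaussianFamily X P) : IsProbabilityMeasure P := by
  have h0 := h.map_sum 0
  have hm : AEMeasurable (fun ω => ∑ i, (0 : ι → ℝ) i * X i ω) P := by simp
  constructor
  have h1 := Measure.map_apply_of_aemeasurable hm MeasurableSet.univ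
  rw [h0, Set.preimage_univ] at h1
  rw [← h1]
  exact measure_univ

/-- Cramér–Wold: the characteristic function of the joint law at `t` is that of `∑ t_i X_i` at `1`,
and `exp (-|t|²/2)` factorises. -/
lemma map_eq_pi (h : IsStdGaussianFamily X P) :
    P.map (fun ω i => X i ω) = Measure.pi fun _ : ι => gaussianReal 0 1 := by
  have := h.isProbabilityMeasure
  have hX : Measurable fun ω i => X i ω := measurable_pi_lambda _ h.measurable
  have : IsProbabilityMeasure (P.map fun ω i => X i ω) :=
    Measure.isProbabilityMeasure_map hX.aemeasurable
  rw [← charFun_eq_pi_iff]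
  intro t
  have h1 : charFun ((P.map fun ω i => X i ω).map (WithLp.toLp 2)) t =
      charFun (P.map (fun ω => ∑ i, t i * X i ω)) 1 := by
    have hs : Measurable fun ω => ∑ i, t i * X i ω :=
      Finset.measurable_sum _ fun i _ => (h.measurable i).const_mul _
    rw [charFun_apply, charFun_apply, integral_map (by fun_prop) (by fun_prop),
      integral_map hX.aemeasurable (by fun_prop), integral_map hs.aemeasurable (by fun_prop)]
    simp [PiLp.inner_apply]
  have h2 : (0 : ℝ) ≤ ∑ i, t i ^ 2 := Finset.sum_nonneg fun i _ => sq_nonneg _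
  rw [h1, h.map_sum]
  simp only [charFun_gaussianReal, ← Complex.exp_sum]
  congr 1
  simp [Real.coe_toNNReal _ h2, Finset.sum_div]

/-- A combination of the new variables with coefficients `c` is one of the old variables with
coefficients `c U`, a vector of the same length. -/
lemma orthogonal_comp [DecidableEq ι] (h : IsStdGaussianFamily X P) (U : Matrix ι ι ℝ)
    (hU : U * U.transpose = 1) : IsStdGaussianFamily (fun i ω => ∑ k, U i k * X k ω) P := by
  refine ⟨fun i => Finset.measurable_sum _ fun k _ => (h.measurable k).const_mul _, fun c => ?_⟩
  have h1 := h.map_sum (fun k => ∑ i, c i * U i k)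
  have h2 : (fun ω => ∑ i, c i * ∑ k, U i k * X k ω) =
      fun ω => ∑ k, (∑ i, c i * U i k) * X k ω := by
    ext ω
    simp_rw [Finset.mul_sum, Finset.sum_mul]
    rw [Finset.sum_comm]
    simp_rw [mul_assoc]
  have h3 : ∑ k, (∑ i, c i * U i k) ^ 2 = ∑ i, c i ^ 2 := by
    have e : Matrix.vecMul c U ⬝ᵥ Matrix.vecMul c U = c ⬝ᵥ c := by
      rw [← Matrix.dotProduct_mulVec, ← Matrix.vecMul_transpose, Matrix.vecMul_vecMul, hU,
        Matrix.vecMul_one]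
    simpa [dotProduct, Matrix.vecMul, sq] using e
  rw [h2, h1, h3]

end IsStdGaussianFamily

/-! ### Exponential moments of sums of squares of Gaussians -/

/-- This is `-log (1 - y) ≤ y + y²`, used at `y = 2s` to control `(1 - 2s)^(-1/2)`. -/
lemma one_le_exp_mul_one_sub {y : ℝ} (hy : |y| ≤ 1 / 2) : 1 ≤ Real.exp (y + y ^ 2) * (1 - y) := by
  obtain ⟨h1, h2⟩ := abs_le.1 hy
  rcases le_total 0 y with h | h
  -- The linear bound on `exp` yields `(1 + y + y²)(1 - y) = 1 - y³`. This is enough for `y ≤ 0`,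
  -- but for `y ≥ 0` the quadratic term is needed.
  · have := Real.quadratic_le_exp_of_nonneg (x := y + y ^ 2) (by positivity)
    nlinarith [mul_le_mul_of_nonneg_right this (by linarith : 0 ≤ 1 - y), mul_nonneg h h,
      mul_nonneg (mul_nonneg h h) h, mul_nonneg (mul_nonneg h h) (by linarith : 0 ≤ 1 - 2 * y)]
  · have := Real.add_one_le_exp (y + y ^ 2)
    have h3 : 0 ≤ -y * y ^ 2 := mul_nonneg (by linarith) (sq_nonneg y)
    nlinarith [mul_le_mul_of_nonneg_right this (by linarith : 0 ≤ 1 - y)]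

lemma exp_sq_mul_gaussianPDFReal (s x : ℝ) : Real.exp (s * x ^ 2) * gaussianPDFReal 0 1 x =
    (Real.sqrt (2 * Real.pi))⁻¹ * Real.exp (-(1 / 2 - s) * x ^ 2) := by
  simp only [gaussianPDFReal, NNReal.coe_one, mul_one, sub_zero]
  rw [mul_left_comm, ← Real.exp_add]
  ring_nf

lemma integrable_exp_sq_gaussianReal {s : ℝ} (hs : s < 1 / 2) :
    Integrable (fun x => Real.exp (s * x ^ 2)) (gaussianReal 0 1) := by
  rw [gaussianReal_of_var_ne_zero _ one_ne_zero, gaussianPDF_def]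
  rw [integrable_withDensity_iff_integrable_smul₀' (by fun_prop) (by simp)]
  simp only [ENNReal.toReal_ofReal (gaussianPDFReal_nonneg _ _ _), smul_eq_mul]
  simp_rw [mul_comm (gaussianPDFReal _ _ _), exp_sq_mul_gaussianPDFReal]
  exact (integrable_exp_neg_mul_sq (by linarith)).const_mul _

/-- The integral equals `(1 - 2s)^(-1/2)`. The first-order term `s` is kept exact, with a
second-order error, so that it can cancel when summed over a trace-free spectrum. -/
lemma integral_exp_sq_gaussianReal_le {s : ℝ} (hs : |s| ≤ 1 / 4) :
    ∫ x, Real.exp (s * x ^ 2) ∂gaussianReal 0 1 ≤ Real.exp (s + 2 * s ^ 2) := by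
  have hs' := abs_le.1 hs
  have h0 : 0 < 1 - 2 * s := by linarith
  rw [integral_gaussianReal_eq_integral_smul one_ne_zero]
  simp only [smul_eq_mul]
  simp_rw [mul_comm (gaussianPDFReal _ _ _), exp_sq_mul_gaussianPDFReal]
  rw [integral_const_mul, integral_gaussian, ← Real.sqrt_inv, ← Real.sqrt_mul (by positivity)]
  refine Real.sqrt_le_iff.2 ⟨(Real.exp_pos _).le, ?_⟩
  have h1 := one_le_exp_mul_one_sub (y := 2 * s) (by
    rw [abs_mul, abs_of_pos (by norm_num : (0:ℝ) < 2)]; linarith)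
  have e : (2 * Real.pi)⁻¹ * (Real.pi / (1 / 2 - s)) = 1 / (1 - 2 * s) := by
    have : (1 / 2 - s) ≠ 0 := by linarith
    have := Real.pi_pos
    field_simp
  rw [e, div_le_iff₀ h0, ← Real.exp_nat_mul]
  have e2 : ((2 : ℕ) : ℝ) * (s + 2 * s ^ 2) = 2 * s + (2 * s) ^ 2 := by push_cast; ring
  rwa [e2]

namespace IsStdGaussianFamily

variable {X : ι → Ω → ℝ} {P : Measure Ω}

lemma integrable_exp_diagonal (h : IsStdGaussianFamily X P) (l : ι → ℝ)
    (hl : ∀ i, l i < 1 / 2) : Integrable (fun ω => Real.exp (∑ i, l i * X i ω ^ 2)) P := by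
  have hX : Measurable fun ω i => X i ω := measurable_pi_lambda _ h.measurable
  have h1 : Integrable (fun x : ι → ℝ => ∏ i, Real.exp (l i * x i ^ 2))
      (P.map fun ω i => X i ω) := by
    rw [h.map_eq_pi]
    exact Integrable.fintype_prod_dep fun i => integrable_exp_sq_gaussianReal (hl i)
  simp_rw [Real.exp_sum]
  exact h1.comp_measurable hX

/-- By independence the expectation is a product of one-dimensional integrals. The linear parts of
the exponents add up to the trace, which is zero. -/
lemma integral_exp_diagonal_le (h : IsStdGaussianFamily X P) (l : ι → ℝ)
    (hl : ∀ i, |l i| ≤ 1 / 4) (hl0 : ∑ i, l i = 0) :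
    ∫ ω, Real.exp (∑ i, l i * X i ω ^ 2) ∂P ≤ Real.exp (2 * ∑ i, l i ^ 2) := by
  have hX : Measurable fun ω i => X i ω := measurable_pi_lambda _ h.measurable
  have h1 : ∫ ω, Real.exp (∑ i, l i * X i ω ^ 2) ∂P =
      ∏ i, ∫ x, Real.exp (l i * x ^ 2) ∂gaussianReal 0 1 := by
    rw [← integral_fintype_prod_eq_prod, ← h.map_eq_pi, integral_map hX.aemeasurable
      (Continuous.aestronglyMeasurable (by fun_prop))]
    simp_rw [Real.exp_sum]
  rw [h1]
  calc _ ≤ ∏ i, Real.exp (l i + 2 * l i ^ 2) :=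
        Finset.prod_le_prod (fun i _ => integral_nonneg fun x => (Real.exp_pos _).le)
          fun i _ => integral_exp_sq_gaussianReal_le (hl i)
    _ = _ := by rw [← Real.exp_sum, Finset.sum_add_distrib, hl0, zero_add, Finset.mul_sum]

end IsStdGaussianFamily

/-- A real symmetric matrix is diagonalised by an orthogonal change of coordinates; its trace and
Hilbert–Schmidt norm are read off from the eigenvalues. -/
lemma exists_orthogonal_diagonalization [DecidableEq ι] (A : Matrix ι ι ℝ)
    (hA : A.transpose = A) : ∃ (U : Matrix ι ι ℝ) (l : ι → ℝ), U * U.transpose = 1 ∧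
      (∑ i, l i = ∑ i, A i i) ∧ (∑ i, l i ^ 2 = ∑ i, ∑ j, A i j ^ 2) ∧
      ∀ x : ι → ℝ, ∑ i, ∑ j, A i j * x i * x j = ∑ i, l i * (∑ k, U i k * x k) ^ 2 := by
  have hH : A.IsHermitian := by
    rw [Matrix.IsHermitian, Matrix.conjTranspose_eq_transpose_of_trivial, hA]
  set V : Matrix ι ι ℝ := (hH.eigenvectorUnitary : Matrix ι ι ℝ)
  have hV1 : V.transpose * V = 1 := by
    have := Unitary.coe_star_mul_self hH.eigenvectorUnitary
    rwa [Matrix.star_eq_conjTranspose, Matrix.conjTranspose_eq_transpose_of_trivial] at this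
  set l := hH.eigenvalues
  have hs : A = V * Matrix.diagonal l * V.transpose := by
    have := hH.spectral_theorem
    rw [Unitary.conjStarAlgAut_apply, Matrix.star_eq_conjTranspose,
      Matrix.conjTranspose_eq_transpose_of_trivial] at this
    exact this
  refine ⟨V.transpose, l, by rwa [Matrix.transpose_transpose], ?_, ?_, fun x => ?_⟩
  · have := hH.trace_eq_sum_eigenvalues
    simpa [Matrix.trace] using this.symm
  · have h1 : (A * A.transpose).trace = ∑ i, ∑ j, A i j ^ 2 := by
      simp [Matrix.trace, Matrix.mul_apply, sq]
    have h2 : A * A.transpose = V * (Matrix.diagonal l * Matrix.diagonal l * V.transpose) := by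
      rw [hA]
      nth_rw 1 [hs]
      nth_rw 1 [hs]
      simp only [Matrix.mul_assoc]
      rw [← Matrix.mul_assoc V.transpose V, hV1, Matrix.one_mul]
    rw [← h1, h2, Matrix.trace_mul_comm, Matrix.mul_assoc, hV1, Matrix.mul_one,
      Matrix.diagonal_mul_diagonal, Matrix.trace_diagonal]
    simp [sq]
  · have h1 : ∑ i, ∑ j, A i j * x i * x j = x ⬝ᵥ A.mulVec x := by
      simp only [dotProduct, Matrix.mulVec, Finset.mul_sum]
      exact Finset.sum_congr rfl fun i _ => Finset.sum_congr rfl fun j _ => by ring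
    rw [h1]
    nth_rw 1 [hs]
    rw [← Matrix.mulVec_mulVec, ← Matrix.mulVec_mulVec, Matrix.dotProduct_mulVec,
      ← Matrix.mulVec_transpose]
    simp only [dotProduct, Matrix.mulVec_diagonal]
    refine Finset.sum_congr rfl fun i _ => ?_
    simp only [Matrix.mulVec, dotProduct]
    ring

namespace IsStdGaussianFamily

variable {X : ι → Ω → ℝ} {P : Measure Ω}

/-- Exponential moments of a trace-free quadratic form in independent standard Gaussians. -/
lemma exp_quadratic [DecidableEq ι] (h : IsStdGaussianFamily X P) (A : Matrix ι ι ℝ)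
    (hA : A.transpose = A) (hA0 : ∑ i, A i i = 0) (hA1 : ∑ i, ∑ j, A i j ^ 2 ≤ (1 / 4) ^ 2) :
    Integrable (fun ω => Real.exp (∑ i, ∑ j, A i j * X i ω * X j ω)) P ∧
      ∫ ω, Real.exp (∑ i, ∑ j, A i j * X i ω * X j ω) ∂P ≤ 2 := by
  obtain ⟨U, l, hU, hl0, hl2, hq⟩ := exists_orthogonal_diagonalization A hA
  -- Each eigenvalue is at most the Hilbert–Schmidt norm in absolute value.
  have hl : ∀ i, |l i| ≤ 1 / 4 := fun i => by
    refine abs_le_of_sq_le_sq' (b := 1 / 4) ?_ (by norm_num) |> abs_le.2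
    calc l i ^ 2 ≤ ∑ i, l i ^ 2 :=
          Finset.single_le_sum (f := fun i => l i ^ 2) (fun i _ => sq_nonneg _) (Finset.mem_univ i)
      _ ≤ _ := hl2.le.trans hA1
  have hY := h.orthogonal_comp U hU
  simp_rw [fun ω => hq (fun i => X i ω)]
  refine ⟨hY.integrable_exp_diagonal l fun i => by linarith [(abs_le.1 (hl i)).2],
    (hY.integral_exp_diagonal_le l hl (hl0.trans hA0)).trans ?_⟩
  have h1 : (2 : ℝ) * ∑ i, l i ^ 2 ≤ 1 / 8 := by rw [hl2]; linarith
  calc _ ≤ Real.exp (1 / 8) := Real.exp_le_exp.2 h1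
    _ ≤ 2 := by
      have := Real.exp_bound_div_one_sub_of_interval (x := 1 / 8) (by norm_num) (by norm_num)
      linarith

/-- Moment bound for trace-free quadratic forms: all moments are controlled by the
Hilbert–Schmidt norm of the matrix. -/
lemma lintegral_quadratic_pow_le [DecidableEq ι] (h : IsStdGaussianFamily X P)
    (A : Matrix ι ι ℝ) (hA : A.transpose = A) (hA0 : ∑ i, A i i = 0) {δ : ℝ} (hδ : 0 < δ)
    (hA1 : ∑ i, ∑ j, A i j ^ 2 ≤ δ ^ 2) (n : ℕ) :
    ∫⁻ ω, ENNReal.ofReal (|∑ i, ∑ j, A i j * X i ω * X j ω| ^ n) ∂P ≤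
      ENNReal.ofReal (4 * n.factorial * (4 * δ) ^ n) := by
  -- The scale `1/(4δ)` brings the Hilbert–Schmidt norm down to `1/4`. Only `s²` is prescribed, so
  -- that both signs are covered.
  have key : ∀ s : ℝ, s ^ 2 = (1 / (4 * δ)) ^ 2 →
      Integrable (fun ω => Real.exp (s * ∑ i, ∑ j, A i j * X i ω * X j ω)) P ∧
      ∫ ω, Real.exp (s * ∑ i, ∑ j, A i j * X i ω * X j ω) ∂P ≤ 2 := fun s hs => by
    have := h.exp_quadratic (s • A) (by rw [Matrix.transpose_smul, hA])
      (by simp [← Finset.mul_sum, hA0]) (by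
        simp only [Matrix.smul_apply, smul_eq_mul, mul_pow, ← Finset.mul_sum]
        rw [hs]
        calc _ ≤ (1 / (4 * δ)) ^ 2 * δ ^ 2 := by gcongr
          _ = _ := by field_simp)
    simpa only [Matrix.smul_apply, smul_eq_mul, mul_assoc, ← Finset.mul_sum] using this
  obtain ⟨i1, b1⟩ := key (1 / (4 * δ)) rfl
  obtain ⟨i2, b2⟩ := key (-(1 / (4 * δ))) (by ring)
  set Q := fun ω => ∑ i, ∑ j, A i j * X i ω * X j ω with hQ
  set C : ℝ := n.factorial * (4 * δ) ^ n
  have hC : 0 ≤ C := by positivity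
  -- From `t^n / n! ≤ e^t` at `t = |Q|/(4δ)`; the two signs of `Q` are absorbed by adding both
  -- exponentials.
  have hb : ∀ ω, |Q ω| ^ n ≤
      C * (Real.exp (1 / (4 * δ) * Q ω) + Real.exp (-(1 / (4 * δ)) * Q ω)) := fun ω => by
    have h1 := Real.pow_div_factorial_le_exp (1 / (4 * δ) * |Q ω|) (by positivity) n
    have h2 : Real.exp (1 / (4 * δ) * |Q ω|) ≤
        Real.exp (1 / (4 * δ) * Q ω) + Real.exp (-(1 / (4 * δ)) * Q ω) := by
      rcases abs_choice (Q ω) with e | e <;> rw [e]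
      · linarith [Real.exp_pos (-(1 / (4 * δ)) * Q ω)]
      · rw [mul_neg, ← neg_mul]
        linarith [Real.exp_pos (1 / (4 * δ) * Q ω)]
    calc |Q ω| ^ n = C * ((1 / (4 * δ) * |Q ω|) ^ n / n.factorial) := by
          simp only [C, mul_pow, div_pow, one_pow]
          field_simp
      _ ≤ _ := mul_le_mul_of_nonneg_left (h1.trans h2) hC
  calc _ ≤ ∫⁻ ω, ENNReal.ofReal
        (C * (Real.exp (1 / (4 * δ) * Q ω) + Real.exp (-(1 / (4 * δ)) * Q ω))) ∂P :=
        lintegral_mono fun ω => ENNReal.ofReal_le_ofReal (hb ω)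
    _ = ENNReal.ofReal
        (∫ ω, C * (Real.exp (1 / (4 * δ) * Q ω) + Real.exp (-(1 / (4 * δ)) * Q ω)) ∂P) :=
        (ofReal_integral_eq_lintegral_ofReal ((i1.add i2).const_mul C)
          (ae_of_all _ fun ω =>
            mul_nonneg hC (add_nonneg (Real.exp_pos _).le (Real.exp_pos _).le))).symm
    _ ≤ _ := by
        refine ENNReal.ofReal_le_ofReal ?_
        rw [integral_const_mul, integral_add i1 i2]
        calc _ ≤ C * (2 + 2) := by gcongr
          _ = _ := by simp only [C]; ring

end IsStdGaussianFamily

end Gaussian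

noncomputable section

/-! ### Real trigonometric monomials -/

/-- The real trigonometric monomial `2 Re (a exp (2πi k·x))`. -/
def trig (a : ℂ) (k : Fin 2 → ℤ) (x : T2) : ℝ := 2 * (a * mFourier k x).re

@[fun_prop]
lemma continuous_trig (a : ℂ) (k : Fin 2 → ℤ) : Continuous (trig a k) := by
  unfold trig
  fun_prop

lemma norm_mFourier_apply (k : Fin 2 → ℤ) (x : T2) : ‖mFourier k x‖ ≤ 1 :=
  (ContinuousMap.norm_coe_le_norm _ x).trans mFourier_norm.le

lemma abs_trig_le (a : ℂ) (k : Fin 2 → ℤ) (x : T2) : |trig a k x| ≤ 2 * ‖a‖ := by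
  rw [trig, abs_mul, abs_of_pos (by norm_num : (0:ℝ) < 2)]
  refine mul_le_mul_of_nonneg_left ((Complex.abs_re_le_norm _).trans ?_) (by norm_num)
  rw [norm_mul]
  exact mul_le_of_le_one_right (norm_nonneg _) (norm_mFourier_apply k x)

/-- From `2 Re z · 2 Re w = 2 Re (z w) + 2 Re (z w̄)`. Both the orthonormality of the basis and the
constraint on frequencies in triple products follow from it. -/
lemma trig_mul_trig (a b : ℂ) (k j : Fin 2 → ℤ) (x : T2) :
    trig a k x * trig b j x =
      trig (a * b) (k + j) x + trig (a * (starRingEnd ℂ) b) (k - j) x := by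
  simp only [trig, sub_eq_add_neg, mFourier_add, mFourier_neg, Complex.mul_re, Complex.mul_im,
    Complex.conj_re, Complex.conj_im]
  ring

lemma real_smul_trig (c : ℝ) (a : ℂ) (k : Fin 2 → ℤ) (x : T2) :
    trig (c * a) k x = c * trig a k x := by
  rw [trig, trig, mul_assoc, Complex.re_ofReal_mul]
  ring

lemma integral_mFourier (k : Fin 2 → ℤ) :
    ∫ x, mFourier k x ∂torusMeasure = if k = 0 then 1 else 0 := by
  have h := integral_fintype_prod_eq_prod (ι := Fin 2) (𝕜 := ℂ)
    (μ := fun _ => (haarAddCircle : Measure UnitAddCircle)) (fun i u => fourier (k i) u)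
  have h1 : ∀ n : ℤ, ∫ u, fourier n u ∂(haarAddCircle : Measure UnitAddCircle) =
      if n = 0 then 1 else 0 := fun n => by
    have := (orthonormal_iff_ite.1 (orthonormal_fourier (T := 1))) 0 n
    rw [ContinuousMap.inner_toLp] at this
    simpa [eq_comm] using this
  simp only [mFourier, ContinuousMap.coe_mk]
  rw [h]
  simp only [h1, Fin.prod_univ_two, funext_iff, Fin.forall_fin_two, Pi.zero_apply]
  split_ifs <;> simp_all

lemma integrable_of_continuous_torus {E : Type*} [NormedAddCommGroup E] {f : T2 → E}
    (hf : Continuous f) : Integrable f torusMeasure :=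
  hf.integrable_of_hasCompactSupport (HasCompactSupport.of_compactSpace f)

lemma integral_trig (a : ℂ) (k : Fin 2 → ℤ) :
    ∫ x, trig a k x ∂torusMeasure = if k = 0 then 2 * a.re else 0 := by
  have h : ∫ x, (a * mFourier k x).re ∂torusMeasure = (a * ∫ x, mFourier k x ∂torusMeasure).re := by
    rw [← integral_const_mul]
    exact integral_re (𝕜 := ℂ) (integrable_of_continuous_torus
      (f := fun x => a * mFourier k x) (by fun_prop))
  simp only [trig]
  rw [integral_const_mul, h, integral_mFourier]
  split_ifs <;> simp

/-- The complex amplitude of the basis function `e_k`. -/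
def amp (k : Z20) : ℂ :=
  open Classical in if IsPlus k then (Real.sqrt 2 / 2 : ℝ) else -(Real.sqrt 2 / 2 : ℝ) * Complex.I

lemma realBasis_eq_trig (k : Z20) : (realBasis k).1 = trig (amp k) k.1 := by
  ext x
  have h : ((realBasis k).1 : T2 → ℝ) = Real.sqrt 2 •
      (open Classical in if IsPlus k then cosFun k.1 else sinFun k.1 : smoothFun).1 := rfl
  rw [h, amp, trig]
  split_ifs
  · rw [Complex.re_ofReal_mul]
    simp only [cosFun, Pi.smul_apply, smul_eq_mul]
    ring
  · simp only [sinFun, Pi.smul_apply, smul_eq_mul, neg_mul, mul_assoc, Complex.neg_re,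
      Complex.re_ofReal_mul, Complex.I_mul_re]
    ring

lemma normSq_amp (k : Z20) : amp k * (starRingEnd ℂ) (amp k) = (1 / 2 : ℝ) := by
  rw [Complex.mul_conj]
  congr 1
  have h : Real.sqrt 2 * Real.sqrt 2 = 2 := Real.mul_self_sqrt (by norm_num)
  unfold amp
  split_ifs
  · rw [Complex.normSq_ofReal]
    linarith
  · rw [← Complex.ofReal_neg, Complex.normSq_mul, Complex.normSq_ofReal, Complex.normSq_I]
    linarith

lemma norm_amp (k : Z20) : ‖amp k‖ ^ 2 = 1 / 2 := by
  have h := normSq_amp k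
  rw [Complex.mul_conj'] at h
  exact_mod_cast h

lemma isPlus_or (k : Z20) : IsPlus k ∨ IsPlus ⟨-k.1, neg_ne_zero.2 k.2⟩ := by
  have h : ¬ (k.1 0 = 0 ∧ k.1 1 = 0) := fun h => k.2 (by
    ext i; fin_cases i
    · exact h.1
    · exact h.2)
  simp only [IsPlus, Pi.neg_apply]
  omega

lemma not_isPlus_and (k : Z20) : ¬ (IsPlus k ∧ IsPlus ⟨-k.1, neg_ne_zero.2 k.2⟩) := by
  simp only [IsPlus, Pi.neg_apply]
  omega

/-- Exactly one of `k` and `-k` lies in the half lattice, so one amplitude is real and the other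
purely imaginary. -/
lemma re_amp_mul_amp {k j : Z20} (h : k.1 + j.1 = 0) : (amp k * amp j).re = 0 := by
  have hj : j = ⟨-k.1, neg_ne_zero.2 k.2⟩ := Subtype.ext (neg_eq_of_add_eq_zero_right h).symm
  have h1 := isPlus_or k
  have h2 := not_isPlus_and k
  rw [← hj] at h1 h2
  unfold amp
  split_ifs <;> first | tauto | simp

lemma integral_realBasis (k : Z20) : ∫ x, (realBasis k).1 x ∂torusMeasure = 0 := by
  rw [realBasis_eq_trig, integral_trig, if_neg k.2]

/-- Of the two frequencies `k ± j`, the sum vanishes only for a sine against the cosine of opposite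
frequency, which contributes zero; the difference gives the Kronecker delta. -/
lemma integral_realBasis_mul (k j : Z20) :
    ∫ x, (realBasis k).1 x * (realBasis j).1 x ∂torusMeasure = if k = j then 1 else 0 := by
  simp only [realBasis_eq_trig, trig_mul_trig]
  rw [integral_add (integrable_of_continuous_torus (by fun_prop))
    (integrable_of_continuous_torus (by fun_prop)), integral_trig, integral_trig]
  have h1 : (if k.1 + j.1 = 0 then 2 * (amp k * amp j).re else 0) = 0 := by
    split_ifs with h
    · rw [re_amp_mul_amp h, mul_zero]
    · rfl
  rw [h1, zero_add]
  simp only [sub_eq_zero, Subtype.coe_inj]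
  split_ifs with h
  · rw [h, normSq_amp, Complex.ofReal_re]
    norm_num
  · rfl

/-! ### White noise in Fourier coordinates -/

lemma measurable_pair (φ : smoothFun) : Measurable fun ω : HNegOneMinus => ω.pair φ := by
  rw [measurable_iff_comap_le]
  exact le_iSup (fun φ : smoothFun => MeasurableSpace.comap
    (fun ω : HNegOneMinus => ω.pair φ) inferInstance) φ

/-- A linear combination of coordinates is the pairing with one zero-average test function, whose
squared `L²` norm is `∑ c_k²` by orthonormality. -/
lemma IsWhiteNoise.isStdGaussianFamily {μ : Measure HNegOneMinus} (hμ : IsWhiteNoise μ)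
    (s : Finset Z20) :
    IsStdGaussianFamily (fun (k : s) (ω : HNegOneMinus) => ω.pair (realBasis k.1)) μ := by
  refine ⟨fun k => measurable_pair _, fun c => ?_⟩
  have hφ : ∀ x, (∑ k, c k • realBasis k.1 : smoothFun).1 x = ∑ k, c k * (realBasis k.1).1 x := by
    intro x
    simp
  have hint : ∀ k : Z20, Continuous (realBasis k).1 := fun k => by
    rw [realBasis_eq_trig]; fun_prop
  have h := hμ.map_pair (∑ k, c k • realBasis k.1) (by
    simp only [hφ]
    rw [integral_finsetSum _ fun k _ => integrable_of_continuous_torus ((hint _).const_mul _)]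
    simp [integral_const_mul, integral_realBasis])
  have h2 : ∫ x, (∑ k, c k • realBasis k.1 : smoothFun).1 x ^ 2 ∂torusMeasure = ∑ k, c k ^ 2 := by
    simp only [hφ, sq, Finset.sum_mul_sum]
    rw [integral_finsetSum _ fun k _ => integrable_of_continuous_torus (by
      have := hint; fun_prop)]
    refine Finset.sum_congr rfl fun k _ => ?_
    rw [integral_finsetSum _ fun j _ => integrable_of_continuous_torus (by
      have := hint; fun_prop)]
    simp_rw [mul_mul_mul_comm (c k), integral_const_mul, integral_realBasis_mul]
    simp
  rw [h2] at h
  rw [← h]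
  congr 1
  ext ω
  simp

/-! ### Velocity and gradient of trigonometric monomials -/

lemma isNegInvariant_torusMeasure : torusMeasure.IsNegInvariant := by
  have : (haarAddCircle : Measure UnitAddCircle).IsNegInvariant :=
    Measure.IsAddHaarMeasure.isNegInvariant_of_innerRegular _
  exact Measure.pi.isNegInvariant _

/-- Convolution acts on a character as multiplication by the Fourier coefficient of the kernel,
after the substitution `y ↦ x - y`. -/
lemma integral_kernel_mul_mFourier (k : Fin 2 → ℤ) (x : T2) (j : Fin 2) :
    ∫ y, (biotSavartKernel (x - y) j : ℂ) * mFourier k y ∂torusMeasure =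
      2 * Real.pi * Complex.I * ((perp k j / normSq k : ℝ) : ℂ) * mFourier k x := by
  rw [← isBiotSavartKernel_biotSavartKernel.coeff j k]
  have := isNegInvariant_torusMeasure
  have h1 := integral_sub_left_eq_self (μ := torusMeasure)
    (fun y => (biotSavartKernel y j : ℂ) * mFourier k (x - y)) x
  simp only [sub_sub_cancel] at h1
  rw [h1]
  unfold mFourierCoeff
  rw [mul_comm, ← integral_const_mul]
  refine integral_congr_ae (Eventually.of_forall fun y => ?_)
  have h2 : mFourier k (x - y) = mFourier k x * mFourier (-k) y := by
    rw [mFourier_neg]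
    simp only [mFourier, ContinuousMap.coe_mk, map_prod, ← Finset.prod_mul_distrib, Pi.sub_apply]
    refine Finset.prod_congr rfl fun i _ => ?_
    rw [← fourier_neg]
    simp only [fourier_apply, sub_eq_add_neg, smul_add, toCircle_add, neg_smul, smul_neg,
      Circle.coe_mul]
  simp only [h2, smul_eq_mul]
  ring

lemma integrable_kernel_sub (x : T2) (j : Fin 2) :
    Integrable (fun y => biotSavartKernel (x - y) j) torusMeasure :=
  have := isNegInvariant_torusMeasure
  (isBiotSavartKernel_biotSavartKernel.integrable j).comp_sub_left x

lemma integrable_kernel_mul {f : T2 → ℝ} (hf : Continuous f) (x : T2) (j : Fin 2) :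
    Integrable (fun y => biotSavartKernel (x - y) j * f y) torusMeasure := by
  obtain ⟨C, hC⟩ := isCompact_univ.exists_bound_of_continuousOn hf.continuousOn
  exact (integrable_kernel_sub x j).mul_bdd (c := C) hf.aestronglyMeasurable
    (Eventually.of_forall fun y => hC y (Set.mem_univ y))

/-- The Biot–Savart multiplier is `i` times a real number; the `i` is moved into the amplitude.
Differentiation also produces a factor `i`, so velocity and gradient of a mode are real multiples of
the same conjugate mode. -/
lemma velocity_trig (a : ℂ) (k : Fin 2 → ℤ) (x : T2) (j : Fin 2) :
    velocity (trig a k) x j =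
      2 * Real.pi * (perp k j / normSq k) * trig (Complex.I * a) k x := by
  have hi : Integrable (fun y => (biotSavartKernel (x - y) j : ℂ) * mFourier k y) torusMeasure :=
    (integrable_kernel_sub x j).ofReal.mul_bdd (c := 1)
      (mFourier k).continuous.aestronglyMeasurable
      (Eventually.of_forall fun y => norm_mFourier_apply k y)
  have h : ∀ y, biotSavartKernel (x - y) j * trig a k y =
      2 * (a * ((biotSavartKernel (x - y) j : ℂ) * mFourier k y)).re := fun y => by
    rw [trig, mul_left_comm a, Complex.re_ofReal_mul]
    ring
  have h2 : ∫ y, (a * ((biotSavartKernel (x - y) j : ℂ) * mFourier k y)).re ∂torusMeasure =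
      (∫ y, a * ((biotSavartKernel (x - y) j : ℂ) * mFourier k y) ∂torusMeasure).re :=
    integral_re (𝕜 := ℂ) (hi.const_mul a)
  simp only [velocity, h]
  rw [integral_const_mul, h2, integral_const_mul, integral_kernel_mul_mFourier, ← real_smul_trig,
    trig]
  congr 2
  push_cast
  ring

lemma hasDerivAt_trig (a : ℂ) (k : Fin 2 → ℤ) (x : T2) (j : Fin 2) :
    HasDerivAt (fun t : ℝ => trig a k (x + Pi.single j (t : UnitAddCircle)))
      (2 * Real.pi * k j * trig (Complex.I * a) k x) 0 := by
  have h1 : ∀ t : ℝ, mFourier k (x + Pi.single j (t : UnitAddCircle)) =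
      mFourier k x * Complex.exp (2 * Real.pi * Complex.I * k j * t) := fun t => by
    simp only [mFourier, ContinuousMap.coe_mk, Pi.add_apply]
    have h2 : ∀ i, (fourier (k i) (x i + (Pi.single j (t : UnitAddCircle) : T2) i) : ℂ) =
        fourier (k i) (x i) * fourier (k i) ((Pi.single j (t : UnitAddCircle) : T2) i) := fun i => by
      simp only [fourier_apply, smul_add, toCircle_add, Circle.coe_mul]
    simp only [h2, Finset.prod_mul_distrib]
    congr 1
    rw [Finset.prod_eq_single j]
    · rw [Pi.single_eq_same, fourier_coe_apply]
      simp
    · intro i _ hi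
      rw [Pi.single_eq_of_ne hi, fourier_eval_zero]
    · simp
  have h3 : HasDerivAt (fun t : ℝ => 2 * (a * (mFourier k x *
      Complex.exp (2 * Real.pi * Complex.I * k j * t))))
      (2 * (a * (mFourier k x * (2 * Real.pi * Complex.I * k j)))) 0 := by
    have h4 : HasDerivAt (fun t : ℝ => (2 * Real.pi * Complex.I * k j * t : ℂ))
        (2 * Real.pi * Complex.I * k j) 0 := by
      simpa using (Complex.ofRealCLM.hasDerivAt (x := (0:ℝ))).const_mul
        (2 * Real.pi * Complex.I * k j : ℂ)
    have h5 := h4.cexp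
    simp only [Complex.ofReal_zero, mul_zero, Complex.exp_zero, one_mul] at h5
    exact ((h5.const_mul _).const_mul _).const_mul _
  have h6 := (Complex.reCLM.hasFDerivAt (x := _)).comp_hasDerivAt (0 : ℝ) h3
  have e1 : (fun t : ℝ => trig a k (x + Pi.single j (t : UnitAddCircle))) =
      Complex.reCLM ∘ fun t : ℝ => 2 * (a * (mFourier k x *
      Complex.exp (2 * Real.pi * Complex.I * k j * t))) := by
    ext t
    simp [trig, h1, Complex.mul_re]
  rw [e1]
  refine h6.congr_deriv ?_
  rw [← Complex.ofReal_intCast]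
  have e2 : (2 * (a * (mFourier k x * (2 * Real.pi * Complex.I * ((k j : ℝ) : ℂ)))) : ℂ) =
      ((2 * (2 * Real.pi * k j) : ℝ) : ℂ) * (Complex.I * a * mFourier k x) := by
    push_cast; ring
  rw [e2, Complex.reCLM_apply, Complex.re_ofReal_mul, trig]
  ring

end

noncomputable section

/-! ### The coefficients of the Galerkin drift -/

/-- The mode conjugate to `e_k`: both `u(e_k)` and `∇e_k` are multiples of it. -/
def conjMode (k : Z20) : T2 → ℝ := trig (Complex.I * amp k) k.1

@[fun_prop]
lemma continuous_conjMode (k : Z20) : Continuous (conjMode k) := continuous_trig _ _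

@[fun_prop]
lemma continuous_realBasis (k : Z20) : Continuous (realBasis k).1 := by
  rw [realBasis_eq_trig]
  fun_prop

/-- The integral `∫ e_k^* e_m^* e_l`, where `*` denotes the conjugate mode. -/
def tripleIntegral (l k m : Z20) : ℝ :=
  ∫ x, conjMode k x * conjMode m x * (realBasis l).1 x ∂torusMeasure

/-- `k^⊥ · m`. -/
def cross (k m : Fin 2 → ℤ) : ℝ := perp k 0 * m 0 + perp k 1 * m 1

lemma cross_eq (k m : Fin 2 → ℤ) : cross k m = k 1 * m 0 - k 0 * m 1 := by
  simp only [cross, perp, Matrix.cons_val_zero, Matrix.cons_val_one]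
  ring

/-- The symmetrised coefficients of the quadratic form `ω ↦ ⟨u(ω)·∇ω, e_l⟩`. -/
def driftCoeff (l k m : Z20) : ℝ :=
  2 * Real.pi ^ 2 * cross k.1 m.1 * (1 / normSq k.1 - 1 / normSq m.1) * tripleIntegral l k m

lemma tripleIntegral_comm (l k m : Z20) : tripleIntegral l k m = tripleIntegral l m k := by
  simp only [tripleIntegral, mul_comm (conjMode k _)]

/-- `cross k m` and `1/|k|² - 1/|m|²` both change sign under exchange of `k` and `m`. -/
lemma driftCoeff_comm (l k m : Z20) : driftCoeff l k m = driftCoeff l m k := by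
  simp only [driftCoeff, tripleIntegral_comm l k m, cross_eq]
  ring

/-- This makes the quadratic forms trace-free, hence of mean zero under white noise. -/
lemma driftCoeff_self (l k : Z20) : driftCoeff l k k = 0 := by
  simp [driftCoeff]

lemma galerkinProj_apply (N : ℕ) (ω : HNegOneMinus) (x : T2) :
    (galerkinProj N ω).1 x = ∑ k ∈ box N, ω.pair (realBasis k) * (realBasis k).1 x := by
  simp [galerkinProj]

lemma cylGradient_apply (Λ : Finset Z20) (g : (Λ → ℝ) → ℝ) (ω : HNegOneMinus) (x : T2) :
    (cylGradient Λ g ω).1 x =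
      ∑ l : Λ, fderiv ℝ g (coords Λ ω) (Pi.single l 1) * (realBasis l.1).1 x := by
  simp [cylGradient]

lemma velocity_galerkinProj (N : ℕ) (ω : HNegOneMinus) (x : T2) (j : Fin 2) :
    velocity (galerkinProj N ω).1 x j = ∑ k ∈ box N,
      ω.pair (realBasis k) * (2 * Real.pi * (perp k.1 j / normSq k.1) * conjMode k x) := by
  have h : ∀ k : Z20, velocity (realBasis k).1 x j =
      2 * Real.pi * (perp k.1 j / normSq k.1) * conjMode k x := fun k => by
    rw [realBasis_eq_trig, velocity_trig, conjMode]
  simp only [← h]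
  simp only [velocity, galerkinProj_apply, Finset.mul_sum]
  rw [integral_finsetSum _ fun k _ => integrable_kernel_mul (by fun_prop) x j]
  refine Finset.sum_congr rfl fun k _ => ?_
  rw [← integral_const_mul]
  simp only [mul_left_comm]

lemma partialDeriv_galerkinProj (N : ℕ) (ω : HNegOneMinus) (x : T2) (j : Fin 2) :
    partialDeriv j (galerkinProj N ω).1 x = ∑ k ∈ box N,
      ω.pair (realBasis k) * (2 * Real.pi * k.1 j * conjMode k x) := by
  have h : HasDerivAt (fun t : ℝ => (galerkinProj N ω).1 (x + Pi.single j (t : UnitAddCircle)))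
      (∑ k ∈ box N, ω.pair (realBasis k) * (2 * Real.pi * k.1 j * conjMode k x)) 0 := by
    simp only [galerkinProj_apply]
    refine HasDerivAt.fun_sum fun k _ => HasDerivAt.const_mul _ ?_
    rw [realBasis_eq_trig]
    exact hasDerivAt_trig _ _ _ _
  exact h.deriv

lemma advection_galerkinProj (N : ℕ) (ω : HNegOneMinus) (x : T2) :
    ∑ j : Fin 2, velocity (galerkinProj N ω).1 x j * partialDeriv j (galerkinProj N ω).1 x =
      ∑ k ∈ box N, ∑ m ∈ box N, (2 * Real.pi) ^ 2 * (cross k.1 m.1 / normSq k.1) *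
        (ω.pair (realBasis k) * ω.pair (realBasis m)) * (conjMode k x * conjMode m x) := by
  simp only [velocity_galerkinProj, partialDeriv_galerkinProj, Finset.sum_mul_sum]
  -- The sum over components `j` is moved innermost, where its two terms combine to `cross k m`.
  rw [Finset.sum_comm]
  refine Finset.sum_congr rfl fun k _ => ?_
  rw [Finset.sum_comm]
  refine Finset.sum_congr rfl fun m _ => ?_
  rw [Fin.sum_univ_two, cross]
  ring

/-- The drift paired with the basis function `e_l`, as a quadratic form. -/
def driftForm (l : Z20) (N : ℕ) (ω : HNegOneMinus) : ℝ :=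
  ∑ k ∈ box N, ∑ m ∈ box N,
    driftCoeff l k m * ω.pair (realBasis k) * ω.pair (realBasis m)

lemma integral_advection_mul_realBasis (N : ℕ) (ω : HNegOneMinus) (l : Z20) :
    ∫ x, (∑ k ∈ box N, ∑ m ∈ box N, (2 * Real.pi) ^ 2 * (cross k.1 m.1 / normSq k.1) *
        (ω.pair (realBasis k) * ω.pair (realBasis m)) * (conjMode k x * conjMode m x)) *
        (realBasis l).1 x ∂torusMeasure = driftForm l N ω := by
  have h : ∀ k m : Z20, Continuous fun x => (2 * Real.pi) ^ 2 * (cross k.1 m.1 / normSq k.1) *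
        (ω.pair (realBasis k) * ω.pair (realBasis m)) *
        (conjMode k x * conjMode m x * (realBasis l).1 x) := fun k m => by fun_prop
  have e : ∀ x, (∑ k ∈ box N, ∑ m ∈ box N, (2 * Real.pi) ^ 2 * (cross k.1 m.1 / normSq k.1) *
        (ω.pair (realBasis k) * ω.pair (realBasis m)) * (conjMode k x * conjMode m x)) *
        (realBasis l).1 x =
      ∑ k ∈ box N, ∑ m ∈ box N, (2 * Real.pi) ^ 2 * (cross k.1 m.1 / normSq k.1) *
        (ω.pair (realBasis k) * ω.pair (realBasis m)) *
        (conjMode k x * conjMode m x * (realBasis l).1 x) := fun x => by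
    simp only [Finset.sum_mul, mul_assoc]
  simp only [e]
  rw [integral_finsetSum _ fun k _ => integrable_of_continuous_torus
    (continuous_finsetSum _ fun m _ => h k m)]
  have e2 : ∀ k, ∫ x, ∑ m ∈ box N, (2 * Real.pi) ^ 2 * (cross k.1 m.1 / normSq k.1) *
        (ω.pair (realBasis k) * ω.pair (realBasis m)) *
        (conjMode k x * conjMode m x * (realBasis l).1 x) ∂torusMeasure =
      ∑ m ∈ box N, (2 * Real.pi) ^ 2 * (cross k.1 m.1 / normSq k.1) *
        (ω.pair (realBasis k) * ω.pair (realBasis m)) * tripleIntegral l k m := fun k => by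
    rw [integral_finsetSum _ fun m _ => integrable_of_continuous_torus (h k m)]
    simp only [integral_const_mul, tripleIntegral]
  simp only [e2, driftForm]
  set B : Z20 → Z20 → ℝ := fun k m => (2 * Real.pi) ^ 2 * (cross k.1 m.1 / normSq k.1) *
        (ω.pair (realBasis k) * ω.pair (realBasis m)) * tripleIntegral l k m
  have h3 : ∑ k ∈ box N, ∑ m ∈ box N, B k m = ∑ k ∈ box N, ∑ m ∈ box N, B m k :=
    Finset.sum_comm
  -- The double sum is averaged with its transpose. Antisymmetry of `cross` then produces the
  -- difference `1/|k|² - 1/|m|²`, and `(2π)²/2 = 2π²`.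
  have h4 : ∑ k ∈ box N, ∑ m ∈ box N, B k m =
      ∑ k ∈ box N, ∑ m ∈ box N, (B k m + B m k) / 2 := by
    simp only [← Finset.sum_div, Finset.sum_add_distrib]
    rw [← h3]
    ring
  rw [h4]
  refine Finset.sum_congr rfl fun k _ => Finset.sum_congr rfl fun m _ => ?_
  simp only [B, driftCoeff, tripleIntegral_comm l m k, cross_eq]
  ring

lemma galerkinDrift_eq (Λ : Finset Z20) (g : (Λ → ℝ) → ℝ) (N : ℕ) (ω : HNegOneMinus) :
    galerkinDrift Λ g N ω =
      ∑ l : Λ, fderiv ℝ g (coords Λ ω) (Pi.single l 1) * driftForm l.1 N ω := by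
  set A : T2 → ℝ := fun x =>
    ∑ k ∈ box N, ∑ m ∈ box N, (2 * Real.pi) ^ 2 * (cross k.1 m.1 / normSq k.1) *
      (ω.pair (realBasis k) * ω.pair (realBasis m)) * (conjMode k x * conjMode m x) with hA
  set c : Λ → ℝ := fun l => fderiv ℝ g (coords Λ ω) (Pi.single l 1)
  have hAc : Continuous A := by
    rw [hA]
    fun_prop
  calc galerkinDrift Λ g N ω
      = ∫ x, ∑ l : Λ, c l * (A x * (realBasis l.1).1 x) ∂torusMeasure := by
        refine integral_congr_ae (Eventually.of_forall fun x => ?_)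
        simp only [advection_galerkinProj, cylGradient_apply, Finset.mul_sum]
        exact Finset.sum_congr rfl fun l _ => mul_left_comm _ _ _
    _ = ∑ l : Λ, c l * ∫ x, A x * (realBasis l.1).1 x ∂torusMeasure := by
        rw [integral_finsetSum _ fun l _ => integrable_of_continuous_torus
          (by fun_prop : Continuous fun x => c l * (A x * (realBasis l.1).1 x))]
        simp only [integral_const_mul]
    _ = ∑ l : Λ, c l * driftForm l.1 N ω := by
        simp only [hA, integral_advection_mul_realBasis]

/-! ### Square summability of the coefficients -/

lemma abs_conjMode_le (k : Z20) (x : T2) : |conjMode k x| ≤ Real.sqrt 2 := by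
  refine (abs_trig_le _ _ _).trans (Real.le_sqrt_of_sq_le ?_)
  rw [norm_mul, Complex.norm_I, one_mul, mul_pow, norm_amp]
  norm_num

lemma abs_realBasis_le (k : Z20) (x : T2) : |(realBasis k).1 x| ≤ Real.sqrt 2 := by
  rw [realBasis_eq_trig]
  refine (abs_trig_le _ _ _).trans (Real.le_sqrt_of_sq_le ?_)
  rw [mul_pow, norm_amp]
  norm_num

lemma tripleIntegral_sq_le (l k m : Z20) : tripleIntegral l k m ^ 2 ≤ 8 := by
  have h : ‖tripleIntegral l k m‖ ≤ Real.sqrt 2 * Real.sqrt 2 * Real.sqrt 2 := by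
    have := norm_integral_le_of_norm_le_const (μ := torusMeasure)
      (f := fun x => conjMode k x * conjMode m x * (realBasis l).1 x)
      (C := Real.sqrt 2 * Real.sqrt 2 * Real.sqrt 2) (Eventually.of_forall fun x => by
        rw [norm_mul, norm_mul]
        gcongr
        · exact abs_conjMode_le k x
        · exact abs_conjMode_le m x
        · exact abs_realBasis_le l x)
    rwa [probReal_univ, mul_one] at this
  have h2 : Real.sqrt 2 ^ 2 = 2 := Real.sq_sqrt (by norm_num)
  calc tripleIntegral l k m ^ 2 = ‖tripleIntegral l k m‖ ^ 2 := by
        rw [Real.norm_eq_abs, sq_abs]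
    _ ≤ (Real.sqrt 2 * Real.sqrt 2 * Real.sqrt 2) ^ 2 := by gcongr
    _ = (Real.sqrt 2 ^ 2) ^ 3 := by ring
    _ = 8 := by rw [h2]; norm_num

/-- The product expands into four monomials with frequencies `k ± m ± l`; each integrates to zero
unless its frequency vanishes. Up to an overall sign these are the four cases `l = ±k ± m`. -/
lemma integral_trig_mul_mul_eq_zero {a b c : ℂ} {k m l : Fin 2 → ℤ}
    (h : ∀ s t : ℤˣ, l ≠ s • k + t • m) :
    ∫ x, trig a k x * trig b m x * trig c l x ∂torusMeasure = 0 := by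
  have h1 := h 1 1
  have h2 := h 1 (-1)
  have h3 := h (-1) 1
  have h4 := h (-1) (-1)
  simp only [one_smul, Units.neg_smul] at h1 h2 h3 h4
  simp only [trig_mul_trig, add_mul]
  have hc : ∀ (a : ℂ) (k : Fin 2 → ℤ), Integrable (trig a k) torusMeasure := fun a k =>
    integrable_of_continuous_torus (by fun_prop)
  rw [integral_add ((hc _ _).fun_add (hc _ _)) ((hc _ _).fun_add (hc _ _)),
    integral_add (hc _ _) (hc _ _), integral_add (hc _ _) (hc _ _)]
  simp only [integral_trig]
  rw [if_neg, if_neg, if_neg, if_neg]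
  · simp
  · exact fun e => h2 (by rw [← sub_eq_zero, ← neg_eq_zero, ← e]; abel)
  · exact fun e => h3 (by rw [← sub_eq_zero, ← e]; abel)
  · exact fun e => h1 (by rw [← sub_eq_zero, ← neg_eq_zero, ← e]; abel)
  · exact fun e => h4 (by rw [← sub_eq_zero, ← e]; abel)

lemma tripleIntegral_eq_zero {l k m : Z20} (h : ∀ s t : ℤˣ, l.1 ≠ s • k.1 + t • m.1) :
    tripleIntegral l k m = 0 := by
  simp only [tripleIntegral, conjMode, realBasis_eq_trig]
  exact integral_trig_mul_mul_eq_zero h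

/-- Planar geometry of `p = (a, b)`, `q = (c, d)` and `ℓ = s p + t q`. Since `p × ℓ = t (p × q)` and
`q × ℓ = -s (p × q)`, the area `|p × q|` is at most `|ℓ||p|` and `|ℓ||q|`. The difference `|q|² -
|p|²` is up to sign the inner product of `ℓ` with `s p - t q`, so it is small when `ℓ` is short. -/
lemma cross_sq_mul_sq_le {s t : ℝ} (hs : s ^ 2 = 1) (ht : t ^ 2 = 1) (a b c d : ℝ) :
    (b * c - a * d) ^ 2 * ((c ^ 2 + d ^ 2) - (a ^ 2 + b ^ 2)) ^ 2 ≤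
      4 * ((s * a + t * c) ^ 2 + (s * b + t * d) ^ 2) ^ 2 *
        ((a ^ 2 + b ^ 2) * (c ^ 2 + d ^ 2)) := by
  set L := (s * a + t * c) ^ 2 + (s * b + t * d) ^ 2 with hL
  set A := a ^ 2 + b ^ 2 with hA
  set B := c ^ 2 + d ^ 2 with hB
  set D := b * c - a * d with hD
  have L0 : 0 ≤ L := by positivity
  have A0 : 0 ≤ A := by positivity
  have B0 : 0 ≤ B := by positivity
  have h1 : D ^ 2 ≤ L * A := by
    have e : L * A = t ^ 2 * D ^ 2 + (a * (s * a + t * c) + b * (s * b + t * d)) ^ 2 := by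
      rw [hL, hA, hD]; ring
    rw [e, ht]
    nlinarith [sq_nonneg (a * (s * a + t * c) + b * (s * b + t * d))]
  have h2 : D ^ 2 ≤ L * B := by
    have e : L * B = s ^ 2 * D ^ 2 + (c * (s * a + t * c) + d * (s * b + t * d)) ^ 2 := by
      rw [hL, hB, hD]; ring
    rw [e, hs]
    nlinarith [sq_nonneg (c * (s * a + t * c) + d * (s * b + t * d))]
  -- Cauchy–Schwarz gives `(B - A)² ≤ L M`, and the parallelogram law gives `M ≤ 2 (A + B)`.
  have h3 : (B - A) ^ 2 ≤ 2 * L * (A + B) := by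
    set M := (s * a - t * c) ^ 2 + (s * b - t * d) ^ 2 with hM
    have e1 : L + M = 2 * (A + B) := by
      have : L + M = 2 * (s ^ 2 * A + t ^ 2 * B) := by rw [hL, hM, hA, hB]; ring
      rw [this, hs, ht]; ring
    have e2 : (B - A) ^ 2 ≤ L * M := by
      have e3 : s ^ 2 * A - t ^ 2 * B =
          (s * a + t * c) * (s * a - t * c) + (s * b + t * d) * (s * b - t * d) := by
        rw [hA, hB]; ring
      rw [hs, ht, one_mul, one_mul] at e3
      have e4 : (B - A) ^ 2 = (A - B) ^ 2 := by ring
      have e5 : L * M = (A - B) ^ 2 +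
          ((s * a + t * c) * (s * b - t * d) - (s * b + t * d) * (s * a - t * c)) ^ 2 := by
        rw [e3, hL, hM]; ring
      rw [e4, e5]
      nlinarith [sq_nonneg ((s * a + t * c) * (s * b - t * d) - (s * b + t * d) * (s * a - t * c))]
    nlinarith
  calc D ^ 2 * (B - A) ^ 2 ≤ D ^ 2 * (2 * L * (A + B)) := by gcongr
    _ = 2 * L * (A * D ^ 2 + B * D ^ 2) := by ring
    -- The two bounds on `D²` are used crosswise, so that both terms become `L A B`.
    _ ≤ 2 * L * (A * (L * B) + B * (L * A)) := by gcongr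
    _ = _ := by ring

lemma normSq_pos (k : Z20) : 0 < normSq k.1 := by
  have h : 0 ≤ normSq k.1 := by unfold normSq; positivity
  refine lt_of_le_of_ne h fun e => k.2 ?_
  have h0 : ((k.1 0 : ℝ)) ^ 2 = 0 := by
    unfold normSq at e
    nlinarith [sq_nonneg (k.1 0 : ℝ), sq_nonneg (k.1 1 : ℝ)]
  have h1 : ((k.1 1 : ℝ)) ^ 2 = 0 := by
    unfold normSq at e
    nlinarith [sq_nonneg (k.1 0 : ℝ), sq_nonneg (k.1 1 : ℝ)]
  ext i
  fin_cases i
  · exact_mod_cast pow_eq_zero_iff two_ne_zero |>.1 h0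
  · exact_mod_cast pow_eq_zero_iff two_ne_zero |>.1 h1

/-- The geometric bound divided by `|k|⁴|m|⁴` leaves `4|l|⁴/(|k|²|m|²)`; the inequality of means
separates `k` from `m`. The constant is `4 · 2 · 8`, from the prefactor `2π²` squared, this estimate
and the triple integral. -/
lemma driftCoeff_sq_le {l k m : Z20} {s t : ℤˣ} (h : l.1 = s • k.1 + t • m.1) :
    driftCoeff l k m ^ 2 ≤ 64 * Real.pi ^ 4 * normSq l.1 ^ 2 *
      ((1 / normSq k.1) ^ 2 + (1 / normSq m.1) ^ 2) := by
  have hu : ∀ s : ℤˣ, (((s : ℤ) : ℝ)) ^ 2 = 1 := fun s => by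
    have := Int.units_coe_mul_self s
    rw [sq]
    exact_mod_cast this
  have hk := normSq_pos k
  have hm := normSq_pos m
  have h1 := cross_sq_mul_sq_le (hu s) (hu t) (k.1 0) (k.1 1) (m.1 0) (m.1 1)
  have h2 : ∀ i, (l.1 i : ℝ) = (s : ℤ) * k.1 i + (t : ℤ) * m.1 i := fun i => by
    rw [h]
    simp [Units.smul_def]
  rw [← h2, ← h2, ← cross_eq] at h1
  change cross k.1 m.1 ^ 2 * (normSq m.1 - normSq k.1) ^ 2 ≤
    4 * normSq l.1 ^ 2 * (normSq k.1 * normSq m.1) at h1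
  have h3 : cross k.1 m.1 ^ 2 * (1 / normSq k.1 - 1 / normSq m.1) ^ 2 ≤
      2 * normSq l.1 ^ 2 * ((1 / normSq k.1) ^ 2 + (1 / normSq m.1) ^ 2) := by
    calc _ = (cross k.1 m.1 ^ 2 * (normSq m.1 - normSq k.1) ^ 2) *
          ((1 / normSq k.1) ^ 2 * (1 / normSq m.1) ^ 2) := by field_simp
      _ ≤ (4 * normSq l.1 ^ 2 * (normSq k.1 * normSq m.1)) *
          ((1 / normSq k.1) ^ 2 * (1 / normSq m.1) ^ 2) := by gcongr
      _ = 2 * normSq l.1 ^ 2 * (2 * (1 / normSq k.1) * (1 / normSq m.1)) := by field_simp; ring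
      _ ≤ _ := by
        gcongr
        exact two_mul_le_add_sq _ _
  have h4 := tripleIntegral_sq_le l k m
  calc driftCoeff l k m ^ 2 = 4 * Real.pi ^ 4 *
        (cross k.1 m.1 ^ 2 * (1 / normSq k.1 - 1 / normSq m.1) ^ 2) *
        tripleIntegral l k m ^ 2 := by unfold driftCoeff; ring
    _ ≤ 4 * Real.pi ^ 4 *
        (2 * normSq l.1 ^ 2 * ((1 / normSq k.1) ^ 2 + (1 / normSq m.1) ^ 2)) * 8 := by
      gcongr
    _ = _ := by ring

/-- The terms are at most `‖k‖^(-4)` in the sup norm, and the exponent `4` exceeds the dimension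
`2`. -/
lemma summable_inv_normSq_sq : Summable fun k : Z20 => (1 / normSq k.1) ^ 2 := by
  have h := (EisensteinSeries.summable_one_div_norm_rpow (k := 4) (by norm_num)).comp_injective
    (Subtype.val_injective (p := fun k : Fin 2 → ℤ => k ≠ 0))
  refine Summable.of_nonneg_of_le (fun k => by positivity) (fun k => ?_) h
  have h0 : 0 < ‖k.1‖ := norm_pos_iff.2 k.2
  have h1 : ‖k.1‖ ^ 2 ≤ normSq k.1 := by
    have h2 : ∀ i, ‖k.1 i‖ ^ 2 ≤ normSq k.1 := fun i => by
      have e : ‖k.1 i‖ ^ 2 = (k.1 i : ℝ) ^ 2 := by rw [Int.norm_eq_abs, sq_abs]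
      rw [e, normSq]
      fin_cases i
      · simp [sq_nonneg]
      · simp [sq_nonneg]
    have h3 : ‖k.1‖ ≤ Real.sqrt (normSq k.1) :=
      (pi_norm_le_iff_of_nonneg (Real.sqrt_nonneg _)).2 fun i => Real.le_sqrt_of_sq_le (h2 i)
    calc ‖k.1‖ ^ 2 ≤ Real.sqrt (normSq k.1) ^ 2 := by gcongr
      _ = _ := Real.sq_sqrt (normSq_pos k).le
  have e : ‖k.1‖ ^ (-4 : ℝ) = (1 / ‖k.1‖ ^ 2) ^ 2 := by
    rw [Real.rpow_neg h0.le, show (4 : ℝ) = ((4 : ℕ) : ℝ) by norm_num, Real.rpow_natCast]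
    field_simp
  simp only [Function.comp_apply]
  rw [e]
  exact pow_le_pow_left₀ (one_div_pos.2 (normSq_pos k)).le
    (one_div_le_one_div_of_le (by positivity) h1) 2

/-- For fixed `l` and fixed signs in `l = ±k ± m`, either of `k`, `m` determines the other. The
double series therefore collapses to four single lattice sums, and off these four sets the
coefficient is zero. -/
lemma summable_driftCoeff_sq (l : Z20) :
    Summable fun p : Z20 × Z20 => driftCoeff l p.1 p.2 ^ 2 := by
  set f : Z20 → ℝ := fun k => (1 / normSq k.1) ^ 2 with hf
  have hf0 : ∀ k, 0 ≤ f k := fun k => by positivity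
  let S : ℤˣ × ℤˣ → Set (Z20 × Z20) := fun u => {p | l.1 = u.1 • p.1.1 + u.2 • p.2.1}
  set F : Z20 × Z20 → ℝ := fun p => 64 * Real.pi ^ 4 * normSq l.1 ^ 2 * (f p.1 + f p.2) with hF
  have hF0 : ∀ p, 0 ≤ F p := fun p =>
    mul_nonneg (by positivity) (add_nonneg (hf0 _) (hf0 _))
  have hs : ∀ u, Summable ((S u).indicator F) := fun u => by
    rw [← summable_subtype_iff_indicator]
    have i1 : Function.Injective fun p : S u => p.1.1 := by
      rintro ⟨⟨k, m⟩, hp⟩ ⟨⟨k', m'⟩, hp'⟩ (rfl : k = k')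
      have h1 : l.1 = u.1 • k.1 + u.2 • m.1 := hp
      have h2 : l.1 = u.1 • k.1 + u.2 • m'.1 := hp'
      have h3 : m = m' := Subtype.ext
        (MulAction.injective u.2 (add_left_cancel (h1.symm.trans h2)))
      subst h3; rfl
    have i2 : Function.Injective fun p : S u => p.1.2 := by
      rintro ⟨⟨k, m⟩, hp⟩ ⟨⟨k', m'⟩, hp'⟩ (rfl : m = m')
      have h1 : l.1 = u.1 • k.1 + u.2 • m.1 := hp
      have h2 : l.1 = u.1 • k'.1 + u.2 • m.1 := hp'
      have h3 : k = k' := Subtype.ext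
        (MulAction.injective u.1 (add_right_cancel (h1.symm.trans h2)))
      subst h3; rfl
    exact ((summable_inv_normSq_sq.comp_injective i1).add
      (summable_inv_normSq_sq.comp_injective i2)).mul_left _
  refine Summable.of_nonneg_of_le (fun p => sq_nonneg _) (fun p => ?_)
    (summable_sum fun u (_ : u ∈ Finset.univ) => hs u)
  have hn : ∀ u, 0 ≤ (S u).indicator F p := fun u => Set.indicator_nonneg (fun p _ => hF0 p) p
  by_cases h : ∃ u : ℤˣ × ℤˣ, p ∈ S u
  · obtain ⟨u, hu⟩ := h
    calc driftCoeff l p.1 p.2 ^ 2 ≤ F p := driftCoeff_sq_le hu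
      _ = (S u).indicator F p := (Set.indicator_of_mem hu F).symm
      _ ≤ _ := Finset.single_le_sum (f := fun u => (S u).indicator F p) (fun u _ => hn u)
        (Finset.mem_univ u)
  · have h0 : tripleIntegral l p.1 p.2 = 0 :=
      tripleIntegral_eq_zero fun s t e => h ⟨(s, t), e⟩
    rw [driftCoeff, h0]
    simpa using Finset.sum_nonneg fun u _ => hn u

end

/-! ### Convergence in all `L^p` with `p < ∞` -/

section Lp

variable {Ω : Type*} [MeasurableSpace Ω] {P : Measure Ω}

lemma holderTriple_two_mul (p : ℝ≥0∞) : ENNReal.HolderTriple (2 * p) (2 * p) p := by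
  refine ⟨?_⟩
  rw [ENNReal.mul_inv (Or.inl two_ne_zero) (Or.inl ENNReal.ofNat_ne_top), ← add_mul,
    ENNReal.inv_two_add_inv_two, one_mul]

/-- A sequence that is Cauchy in every `L^p` with `p < ∞` has one limit for all `p`. -/
lemma exists_common_limit_of_cauchy {f : ℕ → Ω → ℝ}
    (hf : ∀ p : ℝ≥0∞, 1 ≤ p → p ≠ ∞ → ∀ n, MemLp (f n) p P)
    (hc : ∀ p : ℝ≥0∞, 1 ≤ p → p ≠ ∞ →
      Tendsto (fun n : ℕ × ℕ => eLpNorm (f n.1 - f n.2) p P) atTop (𝓝 0)) :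
    ∃ D : Ω → ℝ, ∀ p : ℝ≥0∞, 1 ≤ p → p ≠ ∞ → MemLp D p P ∧
      Tendsto (fun n => eLpNorm (f n - D) p P) atTop (𝓝 0) := by
  have key : ∀ p : ℝ≥0∞, 1 ≤ p → p ≠ ∞ → ∃ D : Ω → ℝ, MemLp D p P ∧
      Tendsto (fun n => eLpNorm (f n - D) p P) atTop (𝓝 0) := fun p hp hp' => by
    have : Fact (1 ≤ p) := ⟨hp⟩
    have hC : CauchySeq fun n => (hf p hp hp' n).toLp (f n) := by
      rw [EMetric.cauchySeq_iff]
      intro ε hε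
      obtain ⟨⟨a, b⟩, hN⟩ := eventually_atTop.1 ((hc p hp hp').eventually_lt_const hε)
      refine ⟨max a b, fun m hm n hn => ?_⟩
      rw [Lp.edist_toLp_toLp]
      exact hN (m, n) ⟨(le_max_left a b).trans hm, (le_max_right a b).trans hn⟩
    obtain ⟨D, hD⟩ := cauchySeq_tendsto_of_complete hC
    refine ⟨D, Lp.memLp D, ?_⟩
    rw [← Lp.tendsto_Lp_iff_tendsto_eLpNorm'' f (hf p hp hp') D (Lp.memLp D), Lp.toLp_coeFn]
    exact hD
  -- The `L¹` limit serves as the common one: every `L^p` limit agrees with it almost everywhere, by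
  -- uniqueness of limits in measure.
  obtain ⟨D, hD, hD'⟩ := key 1 le_rfl ENNReal.one_ne_top
  refine ⟨D, fun p hp hp' => ?_⟩
  obtain ⟨E, hE, hE'⟩ := key p hp hp'
  have hm : ∀ n, AEStronglyMeasurable (f n) P := fun n => (hf p hp hp' n).1
  have hDE : E =ᵐ[P] D := tendstoInMeasure_ae_unique
    (tendstoInMeasure_of_tendsto_eLpNorm (zero_lt_one.trans_le hp).ne' hm hE.1 hE')
    (tendstoInMeasure_of_tendsto_eLpNorm one_ne_zero hm hD.1 hD')
  refine ⟨hE.ae_eq hDE, hE'.congr fun n => eLpNorm_congr_ae ?_⟩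
  exact (EventuallyEq.refl _ (f n)).sub hDE

/-- An `L^p` bound from a bound on a higher integer moment. -/
lemma eLpNorm_le_of_lintegral_pow_le [IsProbabilityMeasure P] {f : Ω → ℝ}
    (hf : AEStronglyMeasurable f P) {p : ℝ≥0∞} {n : ℕ} (hn : n ≠ 0) (hp : p ≤ n) {c δ : ℝ}
    (hc : 0 ≤ c) (hδ : 0 ≤ δ)
    (h : ∫⁻ ω, ENNReal.ofReal (|f ω| ^ n) ∂P ≤ ENNReal.ofReal (c * δ ^ n)) :
    eLpNorm f p P ≤ ENNReal.ofReal c ^ (1 / (n : ℝ)) * ENNReal.ofReal δ := by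
  refine (eLpNorm_le_eLpNorm_of_exponent_le hp hf).trans ?_
  rw [eLpNorm_eq_lintegral_rpow_enorm_toReal (by exact_mod_cast hn) (ENNReal.natCast_ne_top n),
    ENNReal.toReal_natCast]
  have e : ∀ ω, ‖f ω‖ₑ ^ (n : ℝ) = ENNReal.ofReal (|f ω| ^ n) := fun ω => by
    rw [ENNReal.rpow_natCast, Real.enorm_eq_ofReal_abs, ENNReal.ofReal_pow (abs_nonneg _)]
  simp only [e]
  have hn' : (0 : ℝ) < n := by exact_mod_cast Nat.pos_of_ne_zero hn
  calc _ ≤ ENNReal.ofReal (c * δ ^ n) ^ (1 / (n : ℝ)) := ENNReal.rpow_le_rpow h (by positivity)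
    _ = _ := by
      rw [ENNReal.ofReal_mul hc, ENNReal.mul_rpow_of_nonneg _ _ (by positivity),
        ENNReal.ofReal_pow hδ, ← ENNReal.rpow_natCast, ← ENNReal.rpow_mul,
        mul_one_div_cancel hn'.ne', ENNReal.rpow_one]

/-- Induction by Hölder: each further factor costs a doubling of the exponent, which is harmless
when all finite exponents are available. -/
lemma memLp_pow_of_forall [IsProbabilityMeasure P] {f : Ω → ℝ}
    (hf : ∀ p : ℝ≥0∞, p ≠ ∞ → MemLp f p P) (n : ℕ) :
    ∀ p : ℝ≥0∞, p ≠ ∞ → MemLp (fun ω => f ω ^ n) p P := by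
  induction n with
  | zero => intro p _; simpa using memLp_const (1 : ℝ)
  | succ n ih =>
    intro p hp
    have := holderTriple_two_mul p
    have h2 : 2 * p ≠ ∞ := ENNReal.mul_ne_top ENNReal.ofNat_ne_top hp
    simp only [pow_succ]
    exact (hf _ h2).mul' (ih _ h2)

end Lp

noncomputable section

/-! ### Moments of the drift under white noise -/

lemma IsWhiteNoise.memLp_pair_realBasis {μ : Measure HNegOneMinus} (hμ : IsWhiteNoise μ)
    (k : Z20) (p : ℝ≥0∞) (hp : p ≠ ∞) : MemLp (fun ω => ω.pair (realBasis k)) p μ := by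
  have h := memLp_id_gaussianReal' (μ := 0)
    (v := (∫ x, (realBasis k).1 x ^ 2 ∂torusMeasure).toNNReal) p hp
  rw [← hμ.map_pair _ (integral_realBasis k)] at h
  exact h.comp_of_map (measurable_pair _).aemeasurable

lemma measurable_coords (Λ : Finset Z20) : Measurable (coords Λ) :=
  measurable_pi_lambda _ fun _ => measurable_pair _

lemma measurable_fderiv_coords {Λ : Finset Z20} {g : (Λ → ℝ) → ℝ} (hg : g.HasTemperateGrowth)
    (v : Λ → ℝ) : Measurable fun ω => fderiv ℝ g (coords Λ ω) v := by
  have h : Continuous fun x => fderiv ℝ g x v :=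
    (hg.1.continuous_fderiv (by simp)).clm_apply continuous_const
  exact h.measurable.comp (measurable_coords Λ)

lemma memLp_norm_coords {μ : Measure HNegOneMinus} (hμ : IsWhiteNoise μ) (Λ : Finset Z20)
    (p : ℝ≥0∞) (hp : p ≠ ∞) : MemLp (fun ω => ‖coords Λ ω‖) p μ := by
  have h : MemLp (fun ω : HNegOneMinus => ∑ l : Λ, |ω.pair (realBasis l.1)|) p μ :=
    memLp_finsetSum _ fun l _ => (hμ.memLp_pair_realBasis l.1 p hp).abs
  refine h.mono (measurable_coords Λ).norm.aestronglyMeasurable (ae_of_all _ fun ω => ?_)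
  rw [norm_norm]
  refine le_trans ?_ (le_abs_self _)
  exact (pi_norm_le_iff_of_nonneg (Finset.sum_nonneg fun _ _ => abs_nonneg _)).2 fun l =>
    Finset.single_le_sum (f := fun l : Λ => |ω.pair (realBasis l.1)|)
      (fun _ _ => abs_nonneg _) (Finset.mem_univ l)

lemma exists_abs_fderiv_apply_le {E : Type*} [NormedAddCommGroup E] [NormedSpace ℝ E]
    {g : E → ℝ} (hg : g.HasTemperateGrowth) (v : E) :
    ∃ (n : ℕ) (C : ℝ), ∀ x, ‖fderiv ℝ g x v‖ ≤ ‖C * (1 + ‖x‖) ^ n‖ := by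
  obtain ⟨n, C, hC⟩ := hg.2 1
  refine ⟨n, C * ‖v‖, fun x => ?_⟩
  have h := hC x
  rw [norm_iteratedFDeriv_one] at h
  calc ‖fderiv ℝ g x v‖ ≤ ‖fderiv ℝ g x‖ * ‖v‖ := ContinuousLinearMap.le_opNorm _ _
    _ ≤ C * (1 + ‖x‖) ^ n * ‖v‖ := by gcongr
    _ = C * ‖v‖ * (1 + ‖x‖) ^ n := by ring
    _ ≤ _ := le_abs_self _

/-- The derivative grows at most polynomially in Gaussian coordinates, which have all moments. -/
lemma memLp_fderiv_coords {μ : Measure HNegOneMinus} (hμ : IsWhiteNoise μ) {Λ : Finset Z20}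
    {g : (Λ → ℝ) → ℝ} (hg : g.HasTemperateGrowth) (v : Λ → ℝ) (p : ℝ≥0∞) (hp : p ≠ ∞) :
    MemLp (fun ω => fderiv ℝ g (coords Λ ω) v) p μ := by
  have := hμ.isProbabilityMeasure
  obtain ⟨n, C, hC⟩ := exists_abs_fderiv_apply_le hg v
  have h1 : ∀ p : ℝ≥0∞, p ≠ ∞ → MemLp (fun ω => 1 + ‖coords Λ ω‖) p μ := fun p hp => by
    have h0 : MemLp (fun _ : HNegOneMinus => (1 : ℝ)) p μ := memLp_const 1
    exact h0.add (memLp_norm_coords hμ Λ p hp)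
  exact ((memLp_pow_of_forall h1 n p hp).const_mul C).mono
    (measurable_fderiv_coords hg v).aestronglyMeasurable (ae_of_all _ fun ω => hC _)

/-- `L^p` bound for an off-diagonal quadratic form in the Fourier coordinates of white noise. -/
lemma IsWhiteNoise.exists_eLpNorm_quadratic_le {μ : Measure HNegOneMinus} (hμ : IsWhiteNoise μ)
    (p : ℝ≥0∞) (hp : p ≠ ∞) : ∃ C : ℝ≥0∞, C ≠ ∞ ∧ ∀ (s : Finset Z20) (b : Z20 → Z20 → ℝ),
      (∀ k m, b k m = b m k) → (∀ k, b k k = 0) → ∀ δ : ℝ, 0 < δ →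
      ∑ k ∈ s, ∑ m ∈ s, b k m ^ 2 ≤ δ ^ 2 →
      eLpNorm (fun ω => ∑ k ∈ s, ∑ m ∈ s,
        b k m * ω.pair (realBasis k) * ω.pair (realBasis m)) p μ ≤ C * ENNReal.ofReal δ := by
  classical
  have := hμ.isProbabilityMeasure
  -- An integer moment above `p` dominates the `L^p` norm on a probability space. Since `n` depends
  -- on `p` alone, the constant is uniform over index sets and coefficients.
  obtain ⟨n, hn⟩ := ENNReal.exists_nat_gt hp
  have hn0 : n ≠ 0 := by
    rintro rfl
    simp at hn
  refine ⟨ENNReal.ofReal (4 * n.factorial) ^ (1 / (n : ℝ)) * ENNReal.ofReal 4,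
    ENNReal.mul_ne_top (ENNReal.rpow_ne_top_of_nonneg (by positivity) ENNReal.ofReal_ne_top)
      ENNReal.ofReal_ne_top, fun s b hb hb0 δ hδ hs => ?_⟩
  rw [mul_assoc, ← ENNReal.ofReal_mul (by norm_num)]
  have h := (hμ.isStdGaussianFamily s).lintegral_quadratic_pow_le
    (Matrix.of fun k m : s => b k.1 m.1) (by ext k m; exact hb _ _)
    (Finset.sum_eq_zero fun k _ => hb0 k.1) hδ (by
      simp only [Matrix.of_apply]
      rw [Finset.sum_coe_sort s fun k => ∑ m : s, b k m.1 ^ 2]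
      refine (Finset.sum_congr rfl fun k _ => ?_).trans_le hs
      exact Finset.sum_coe_sort s fun m => b k m ^ 2) n
  refine eLpNorm_le_of_lintegral_pow_le ?_ hn0 hn.le (by positivity) (by positivity) ?_
  · exact (Finset.measurable_sum _ fun k _ => Finset.measurable_sum _ fun m _ =>
      ((measurable_pair _).const_mul _).mul (measurable_pair _)).aestronglyMeasurable
  · refine le_trans (le_of_eq ?_) h
    refine lintegral_congr fun ω => ?_
    simp only [Matrix.of_apply]
    rw [Finset.sum_coe_sort s fun k => ∑ m : s,
      b k m.1 * ω.pair (realBasis k) * ω.pair (realBasis m.1)]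
    congr 3
    refine Finset.sum_congr rfl fun k _ => ?_
    exact (Finset.sum_coe_sort s fun m =>
      b k m * ω.pair (realBasis k) * ω.pair (realBasis m)).symm

lemma measurable_driftForm (l : Z20) (N : ℕ) : Measurable (driftForm l N) :=
  Finset.measurable_sum _ fun _ _ => Finset.measurable_sum _ fun _ _ =>
    ((measurable_pair _).const_mul _).mul (measurable_pair _)

lemma memLp_driftForm {μ : Measure HNegOneMinus} (hμ : IsWhiteNoise μ) (l : Z20) (N : ℕ)
    (p : ℝ≥0∞) (hp : p ≠ ∞) : MemLp (driftForm l N) p μ := by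
  obtain ⟨C, hC, h⟩ := hμ.exists_eLpNorm_quadratic_le p hp
  refine ⟨(measurable_driftForm l N).aestronglyMeasurable, ?_⟩
  have h0 : 0 ≤ ∑ k ∈ box N, ∑ m ∈ box N, driftCoeff l k m ^ 2 :=
    Finset.sum_nonneg fun _ _ => Finset.sum_nonneg fun _ _ => sq_nonneg _
  -- For a sum `S ≥ 0` the choice `δ = S + 1` is positive and satisfies `S ≤ δ²`.
  refine (h (box N) (driftCoeff l) (driftCoeff_comm l) (driftCoeff_self l)
    (∑ k ∈ box N, ∑ m ∈ box N, driftCoeff l k m ^ 2 + 1) (by linarith) (by nlinarith)).trans_lt ?_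
  exact ENNReal.mul_lt_top hC.lt_top ENNReal.ofReal_lt_top

/-! ### Exhaustion of the lattice by boxes and the Cauchy property -/

lemma mem_box {N : ℕ} {k : Z20} : k ∈ box N ↔ ∀ i, |k.1 i| ≤ N := by
  simp only [box, Finset.mem_subtype, Finset.mem_Icc, Pi.le_def, ← forall_and, abs_le]

lemma box_mono : Monotone box := fun M N h k hk => by
  rw [mem_box] at hk ⊢
  exact fun i => (hk i).trans (by exact_mod_cast h)

lemma exists_subset_box (s : Finset Z20) : ∃ N, s ⊆ box N := by
  refine ⟨∑ k ∈ s, ∑ i, (k.1 i).natAbs, fun k hk => mem_box.2 fun i => ?_⟩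
  rw [Int.abs_eq_natAbs]
  norm_cast
  exact (Finset.single_le_sum (f := fun i => (k.1 i).natAbs) (fun _ _ => Nat.zero_le _)
    (Finset.mem_univ i)).trans
    (Finset.single_le_sum (f := fun k : Z20 => ∑ i, (k.1 i).natAbs) (fun _ _ => Nat.zero_le _) hk)

/-- The drift form on a larger box minus the one on a smaller box, as a single quadratic form
with small coefficients. -/
lemma driftForm_sub {M N : ℕ} (h : M ≤ N) (l : Z20) (ω : HNegOneMinus) :
    driftForm l N ω - driftForm l M ω = ∑ k ∈ box N, ∑ m ∈ box N,
      (if k ∈ box M ∧ m ∈ box M then 0 else driftCoeff l k m) *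
        ω.pair (realBasis k) * ω.pair (realBasis m) := by
  have hM : driftForm l M ω = ∑ k ∈ box N, ∑ m ∈ box N,
      (if k ∈ box M ∧ m ∈ box M then driftCoeff l k m else 0) *
        ω.pair (realBasis k) * ω.pair (realBasis m) := by
    rw [driftForm, ← Finset.sum_subset (box_mono h)]
    · refine Finset.sum_congr rfl fun k hk => ?_
      rw [← Finset.sum_subset (box_mono h)]
      · exact Finset.sum_congr rfl fun m hm => by rw [if_pos ⟨hk, hm⟩]
      · intro m _ hm
        rw [if_neg fun h => hm h.2, zero_mul, zero_mul]
    · intro k _ hk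
      refine Finset.sum_eq_zero fun m _ => ?_
      rw [if_neg fun h => hk h.1, zero_mul, zero_mul]
  rw [hM, driftForm, ← Finset.sum_sub_distrib]
  refine Finset.sum_congr rfl fun k _ => ?_
  rw [← Finset.sum_sub_distrib]
  refine Finset.sum_congr rfl fun m _ => ?_
  split_ifs <;> ring

/-- Tail of a convergent series: once `box M × box M` contains a suitable finite set of pairs, the
surviving pairs are disjoint from that set. -/
lemma exists_sum_driftCoeff_sq_le (l : Z20) {ε : ℝ} (hε : 0 < ε) : ∃ N₀, ∀ M N, N₀ ≤ M →
    ∑ k ∈ box N, ∑ m ∈ box N,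
      (if k ∈ box M ∧ m ∈ box M then 0 else driftCoeff l k m) ^ 2 ≤ ε := by
  classical
  obtain ⟨s, hs⟩ := summable_iff_vanishing_norm.1 (summable_driftCoeff_sq l) ε hε
  obtain ⟨N₀, hN₀⟩ := exists_subset_box (s.image Prod.fst ∪ s.image Prod.snd)
  refine ⟨N₀, fun M N hM => ?_⟩
  have h1 := hs ((box N ×ˢ box N).filter fun q => ¬ (q.1 ∈ box M ∧ q.2 ∈ box M)) (by
    rw [Finset.disjoint_left]
    intro q hq hqs
    refine (Finset.mem_filter.1 hq).2 ⟨box_mono hM (hN₀ ?_), box_mono hM (hN₀ ?_)⟩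
    · exact Finset.mem_union_left _ (Finset.mem_image_of_mem _ hqs)
    · exact Finset.mem_union_right _ (Finset.mem_image_of_mem _ hqs))
  rw [← Finset.sum_product']
  refine le_trans (le_of_eq ?_) ((le_abs_self _).trans h1.le)
  rw [Finset.sum_filter]
  refine Finset.sum_congr rfl fun q _ => ?_
  split_ifs <;> simp_all

lemma tendsto_eLpNorm_driftForm_sub {μ : Measure HNegOneMinus} (hμ : IsWhiteNoise μ) (l : Z20)
    (p : ℝ≥0∞) (hp : p ≠ ∞) :
    Tendsto (fun n : ℕ × ℕ => eLpNorm (driftForm l n.1 - driftForm l n.2) p μ) atTop (𝓝 0) := by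
  obtain ⟨C, hC, h⟩ := hμ.exists_eLpNorm_quadratic_le p hp
  have hC0 : Tendsto (fun δ : ℝ => C * ENNReal.ofReal δ) (𝓝[>] 0) (𝓝 0) := by
    have h1 : Tendsto (fun δ : ℝ => ENNReal.ofReal δ) (𝓝[>] 0) (𝓝 0) := by
      simpa using (ENNReal.tendsto_ofReal (tendsto_id (x := 𝓝 (0 : ℝ)))).mono_left
        nhdsWithin_le_nhds
    simpa using ENNReal.Tendsto.const_mul h1 (Or.inr hC)
  rw [ENNReal.tendsto_nhds_zero]
  intro ε hε
  obtain ⟨δ, hδε, hδ⟩ := ((ENNReal.tendsto_nhds_zero.1 hC0 ε hε).and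
    self_mem_nhdsWithin).exists
  have hδ0 : 0 < δ := hδ
  obtain ⟨N₀, hN₀⟩ := exists_sum_driftCoeff_sq_le l (pow_pos hδ0 2)
  have key : ∀ M N, N₀ ≤ M → M ≤ N → eLpNorm (driftForm l N - driftForm l M) p μ ≤ ε := by
    intro M N hM hMN
    have e : driftForm l N - driftForm l M = fun ω => ∑ k ∈ box N, ∑ m ∈ box N,
        (if k ∈ box M ∧ m ∈ box M then 0 else driftCoeff l k m) *
          ω.pair (realBasis k) * ω.pair (realBasis m) := funext fun ω => driftForm_sub hMN l ω
    rw [e]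
    -- Removing a square block of index pairs keeps the matrix symmetric with zero diagonal, so the
    -- uniform moment bound applies to the difference.
    refine (h (box N) (fun k m => if k ∈ box M ∧ m ∈ box M then 0 else driftCoeff l k m)
      (fun k m => ?_) (fun k => ?_) δ hδ0 (hN₀ M N hM)).trans hδε
    · simp only [driftCoeff_comm l k m, and_comm]
    · simp only [driftCoeff_self, ite_self]
  filter_upwards [eventually_ge_atTop (N₀, N₀)] with n hn
  rcases le_total n.2 n.1 with h1 | h1
  · exact key _ _ hn.2 h1
  · rw [eLpNorm_sub_comm]
    exact key _ _ hn.1 h1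

/-! ### Products with the gradient of the cylindrical function -/

lemma memLp_galerkinDrift {μ : Measure HNegOneMinus} (hμ : IsWhiteNoise μ) {Λ : Finset Z20}
    {g : (Λ → ℝ) → ℝ} (hg : g.HasTemperateGrowth) (N : ℕ) (p : ℝ≥0∞) (hp : p ≠ ∞) :
    MemLp (galerkinDrift Λ g N) p μ := by
  have := holderTriple_two_mul p
  have h2 : 2 * p ≠ ∞ := ENNReal.mul_ne_top ENNReal.ofNat_ne_top hp
  rw [funext (galerkinDrift_eq Λ g N)]
  exact memLp_finsetSum _ fun l _ =>
    (memLp_driftForm hμ l.1 N _ h2).mul' (memLp_fderiv_coords hμ hg _ _ h2)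

/-- The factors `∂_l g` are the same for every `N`, so in a difference of drifts only the quadratic
forms vary. Hölder with exponents `2p`, `2p` bounds each product by a fixed finite norm times a null
sequence. -/
lemma tendsto_eLpNorm_galerkinDrift_sub {μ : Measure HNegOneMinus} (hμ : IsWhiteNoise μ)
    {Λ : Finset Z20} {g : (Λ → ℝ) → ℝ} (hg : g.HasTemperateGrowth) (p : ℝ≥0∞) (hp1 : 1 ≤ p)
    (hp : p ≠ ∞) :
    Tendsto (fun n : ℕ × ℕ => eLpNorm (galerkinDrift Λ g n.1 - galerkinDrift Λ g n.2) p μ)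
      atTop (𝓝 0) := by
  have := holderTriple_two_mul p
  have h2 : 2 * p ≠ ∞ := ENNReal.mul_ne_top ENNReal.ofNat_ne_top hp
  set c : Λ → HNegOneMinus → ℝ := fun l ω => fderiv ℝ g (coords Λ ω) (Pi.single l 1) with hc
  have hcm : ∀ l, AEStronglyMeasurable (c l) μ := fun l =>
    (measurable_fderiv_coords hg _).aestronglyMeasurable
  have hqm : ∀ (l : Λ) (n : ℕ × ℕ),
      AEStronglyMeasurable (driftForm l.1 n.1 - driftForm l.1 n.2) μ := fun l n =>
    ((measurable_driftForm _ _).sub (measurable_driftForm _ _)).aestronglyMeasurable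
  have e : ∀ n : ℕ × ℕ, galerkinDrift Λ g n.1 - galerkinDrift Λ g n.2 =
      ∑ l : Λ, c l • (driftForm l.1 n.1 - driftForm l.1 n.2) := fun n => by
    ext ω
    rw [Pi.sub_apply, galerkinDrift_eq, galerkinDrift_eq, ← Finset.sum_sub_distrib,
      Finset.sum_apply]
    exact Finset.sum_congr rfl fun l _ => (mul_sub _ _ _).symm
  have hlim : Tendsto (fun n : ℕ × ℕ => ∑ l : Λ, eLpNorm (c l) (2 * p) μ *
      eLpNorm (driftForm l.1 n.1 - driftForm l.1 n.2) (2 * p) μ) atTop (𝓝 0) := by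
    have h3 := tendsto_finsetSum (Finset.univ : Finset Λ) fun l _ =>
      ENNReal.Tendsto.const_mul (a := eLpNorm (c l) (2 * p) μ)
        (tendsto_eLpNorm_driftForm_sub hμ l.1 _ h2)
        (Or.inr (memLp_fderiv_coords hμ hg _ _ h2).eLpNorm_ne_top)
    simpa using h3
  refine tendsto_of_tendsto_of_tendsto_of_le_of_le tendsto_const_nhds hlim
    (fun n => zero_le) fun n => ?_
  simp only [e]
  refine (eLpNorm_sum_le (fun l _ => (hcm l).smul (hqm l n)) hp1).trans
    (Finset.sum_le_sum fun l _ => ?_)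
  exact eLpNorm_smul_le_mul_eLpNorm (hqm l n) (hcm l)

end

end Vorticity

theorem theorem5p4 (μ : Measure HNegOneMinus) (hμ : IsWhiteNoise μ)
    (Λ : Finset Z20) (g : (Λ → ℝ) → ℝ) (hg : g.HasTemperateGrowth) :
    ∃ D : HNegOneMinus → ℝ, ∀ p : ℝ≥0∞, 1 ≤ p → p ≠ ∞ →
      (∀ N : ℕ, MemLp (galerkinDrift Λ g N) p μ) ∧ MemLp D p μ ∧
        Tendsto (fun N : ℕ => eLpNorm (galerkinDrift Λ g N - D) p μ) atTop (𝓝 0) := by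
  obtain ⟨D, hD⟩ := exists_common_limit_of_cauchy
    (fun p _ hp N => memLp_galerkinDrift hμ hg N p hp)
    (fun p hp1 hp => tendsto_eLpNorm_galerkinDrift_sub hμ hg p hp1 hp)
  exact ⟨D, fun p hp1 hp => ⟨fun N => memLp_galerkinDrift hμ hg N p hp, hD p hp1 hp⟩⟩
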